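/- Let $n\ge 1$ and $0\le p\le n-1$ be integers, let $c>0$, and let $\varphi:\mathbb{R}^n\to\mathbb{R}$ be a smooth function such that $$\sum_{j,k=1}^n \frac{\partial^2\varphi}{\partial x_j\partial x_k}(x)\,\omega_j\omega_k\ \ge\ c|\omega|^2\qquad\text{for all } x,\omega\in\mathbb{R}^n .$$ A $q$-form is written $g=\sum'_{|I|=q} g_I\,dx^I$ with real-valued coefficients, the sum running over strictly increasing multi-indices $I$ of length $q$ in $\{1,\dots,n\}$; put $g\cdot h=\sum'_{|I|=q} g_I h_I$ and $|g|^2=g\cdot g$. Let $L^2_q(\mathbb{R}^n,e^{-\varphi})$ be the space of $q$-forms with $g_I\in L^2_{loc}(\mathbb{R}^n)$ for all $I$ and $\int_{\mathbb{R}^n}|g|^2e^{-\varphi}<\infty$. For a $q$-form $g$ and a $(q+1)$-form $h$ with $L^2_{loc}$ coefficients, $dg=h$ in the sense of distributions means that $$-\sum'_{|M|=q+1}\ \sum_{k=1}^{q+1}(-1)^{k-1}\int_{\mathbb{R}^n} g_{M\setminus m_k}\,\frac{\partial\alpha_M}{\partial x_{m_k}}\,dx=\int_{\mathbb{R}^n}h\cdot\alpha\,dx$$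 for every $(q+1)$-form $\alpha$ with smooth compactly supported coefficients, where $M=(m_1<\dots<m_{q+1})$ and $M\setminus m_k$ is $M$ with $m_k$ removed. Then for every $f\in L^2_{p+1}(\mathbb{R}^n,e^{-\varphi})$ with $df=0$ in the sense of distributions there exists $u\in L^2_p(\mathbb{R}^n,e^{-\varphi})$ such that $du=f$ in the sense of distributions and $$\int_{\mathbb{R}^n}|u|^2e^{-\varphi}\ \le\ \frac{1}{c(p+1)}\int_{\mathbb{R}^n}|f|^2e^{-\varphi}.$$ -/

import Mathlib

open MeasureTheory
open scoped ContDiff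

noncomputable section

/-- The partial derivative `∂g/∂x_j` of a real function on `ℝⁿ`. -/
def pderiv {n : ℕ} (j : Fin n) (g : EuclideanSpace ℝ (Fin n) → ℝ)
    (x : EuclideanSpace ℝ (Fin n)) : ℝ :=
  fderiv ℝ g x (EuclideanSpace.single j 1)

/-- A `p`-form on `ℝⁿ` with real coefficients (no regularity required). -/
abbrev DForm (n p : ℕ) : Type :=
  EuclideanSpace ℝ (Fin n) → (EuclideanSpace ℝ (Fin n)) [⋀^Fin p]→L[ℝ] ℝ

/-- The coefficient `f_I` of `f = ∑'_I f_I dx^I`, where `I` is a strictly increasing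
multi-index with values in `{0, …, n-1}`: the value of `f` on `(e_{i_1}, …, e_{i_p})`. -/
def DForm.coeff {n p : ℕ} (f : DForm n p) (I : Fin p ↪o Fin n)
    (x : EuclideanSpace ℝ (Fin n)) : ℝ :=
  f x (fun k => EuclideanSpace.single (I k) 1)

/-- The pointwise scalar product `f · g = ∑'_I f_I g_I`. -/
def DForm.dot {n p : ℕ} (f g : DForm n p) (x : EuclideanSpace ℝ (Fin n)) : ℝ :=
  ∑ I : Fin p ↪o Fin n, f.coeff I x * g.coeff I x

/-- The weighted squared norm `∫ |f|² e^{-φ}`, with `|f|² = f · f`. -/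
def DForm.weightedNormSq {n p : ℕ} (φ : EuclideanSpace ℝ (Fin n) → ℝ) (f : DForm n p) : ℝ :=
  ∫ x, f.dot f x * Real.exp (-φ x)

/-- Membership in `L²_p(ℝⁿ, e^{-φ})`: the coefficients are in `L²_loc` and
`∫ |f|² e^{-φ} < ∞`. -/
structure DForm.MemL2 {n p : ℕ} (φ : EuclideanSpace ℝ (Fin n) → ℝ) (f : DForm n p) : Prop where
  memLp_loc : ∀ I : Fin p ↪o Fin n, ∀ K : Set (EuclideanSpace ℝ (Fin n)), IsCompact K →
    MemLp (f.coeff I) 2 (volume.restrict K)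
  integrable : Integrable (fun x => f.dot f x * Real.exp (-φ x)) volume

/-- A test `p`-form: smooth and compactly supported. -/
structure DForm.IsTest {n p : ℕ} (α : DForm n p) : Prop where
  smooth : ContDiff ℝ ∞ α
  compact : HasCompactSupport α

/-- The increasing multi-index `M` with its `k`-th entry removed. -/
def removeIndex {n p : ℕ} (M : Fin (p + 1) ↪o Fin n) (k : Fin (p + 1)) : Fin p ↪o Fin n :=
  (Fin.succAboveOrderEmb k).trans M

/-- The distributional coefficient
`(du)_M = ∑_{j ∈ M} ε ∂u_{M^j}/∂x_j`, evaluated at a test function `ψ`. For `j` the entry of `M`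
in (zero-based) position `k`, `M^j` is `M` with that entry removed, the sign `ε` of the
permutation sorting `(j, M^j)` is `(-1)^k`, and
`⟨∂u_{M^j}/∂x_j, ψ⟩ = -∫ u_{M^j} ∂ψ/∂x_j`. -/
def DForm.weakDCoeff {n p : ℕ} (u : DForm n p) (M : Fin (p + 1) ↪o Fin n)
    (ψ : EuclideanSpace ℝ (Fin n) → ℝ) : ℝ :=
  ∑ k : Fin (p + 1), (-1) ^ (k : ℕ) * (-∫ x, u.coeff (removeIndex M k) x * pderiv (M k) ψ x)

/-- `du = f` in the sense of distributions: `∫ du · α = ∫ f · α` for all test forms `α`. -/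
def DForm.WeakD {n p : ℕ} (u : DForm n p) (f : DForm n (p + 1)) : Prop :=
  ∀ α : DForm n (p + 1), α.IsTest →
    ∑ M : Fin (p + 1) ↪o Fin n, u.weakDCoeff M (α.coeff M) = ∫ x, f.dot α x

end

/-! This is Hörmander's L² method. Let δ (`codiff`) be the formal adjoint of d in L²(e^{-φ}). Since
multiplication by e^{-φ} permutes the test forms, du = f in the sense of distributions means ⟨u, δα⟩
= ⟨f, α⟩ for all test forms α. By Hahn–Banach and Riesz, such a u with the required norm exists as
soon as c(p+1)|⟨f, α⟩|² ≤ ‖f‖² ‖δα‖² for all test forms α.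

To prove this bound, project α orthogonally to g in the space N of weakly closed forms, the
orthogonal complement of the range of δ on test (p+2)-forms. As f lies in N, ⟨f, α⟩ = ⟨f, g⟩. As
exact test forms lie in N (d² = 0), g still has weak codifferential δα. Everything is thus reduced
to c(p+1)‖g‖² ≤ ‖s‖² for a weakly closed g with weak codifferential s
(`exists_solution_of_estimate`, `mul_norm_sq_le_of_weakly_closed`).

For test forms the estimate is a Bochner identity (`bochner_inequality`): ‖δα‖² + ‖dα‖² equals the
squared norm of the full gradient of α plus a Hessian term. The commutator [∂_i, δ_j] = -∂_i∂_jφ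
produces the Hessian term, and the pointwise identity `sum_sq_alternatizeUncurryFin` makes the
remaining cross terms cancel. Convexity bounds the Hessian term below by c times the sum of squares
of all contractions of α with basis vectors, in which each coefficient occurs p+1 times
(`sum_sq_cons`); this is the source of the constant.

The projection g is merely square integrable, so the estimate is carried over to it by
approximation. The coefficients of g are mollified and multiplied by a cutoff χ; mollification
commutes with the constant-coefficient operators behind d and δ, so dg = 0 survives and only terms
with ∂χ appear (`IsWeakPair.cutoff_estimate`). Letting χ tend to 1 with gradient O(1/R) removes
those terms (`IsWeakPair.estimate`). -/

noncomputable section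

/-! ### Multilinear algebra: coefficients, contractions and the pointwise Weitzenböck identity -/

/-- The tuple `(e_{J 0}, …, e_{J (q-1)})` of standard basis vectors. -/
def basisTuple {n q : ℕ} (J : Fin q → Fin n) : Fin q → EuclideanSpace ℝ (Fin n) :=
  fun k => EuclideanSpace.single (J k) 1

theorem DForm.coeff_eq {n q : ℕ} (f : DForm n q) (I : Fin q ↪o Fin n)
    (x : EuclideanSpace ℝ (Fin n)) : f.coeff I x = f x (basisTuple I) := rfl

theorem basisTuple_cons {n q : ℕ} (j : Fin n) (J : Fin q → Fin n) :
    basisTuple (Fin.cons j J : Fin (q + 1) → Fin n) =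
      Fin.cons (EuclideanSpace.single j 1) (basisTuple J) := by
  funext k
  refine Fin.cases ?_ (fun k => ?_) k <;> simp [basisTuple]

theorem removeNth_basisTuple {n q : ℕ} (J : Fin (q + 1) → Fin n) (k : Fin (q + 1)) :
    k.removeNth (basisTuple J) = basisTuple (k.removeNth J) := rfl

theorem removeNth_coe_orderEmb {n q : ℕ} (M : Fin (q + 1) ↪o Fin n) (k : Fin (q + 1)) :
    k.removeNth (M : Fin (q + 1) → Fin n) = (removeIndex M k : Fin q → Fin n) := rfl

theorem map_basisTuple_eq_zero {n q : ℕ} (A : (EuclideanSpace ℝ (Fin n)) [⋀^Fin q]→L[ℝ] ℝ)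
    {J : Fin q → Fin n} (hJ : ¬ Function.Injective J) : A (basisTuple J) = 0 := by
  simp only [Function.Injective, not_forall] at hJ
  obtain ⟨a, b, hab, hne⟩ := hJ
  exact A.map_eq_zero_of_eq _ (by simp [basisTuple, hab]) hne

/-- An alternating form is determined by its coefficients at increasing multi-indices. -/
theorem alternating_ext_coeff {n q : ℕ} {A B : (EuclideanSpace ℝ (Fin n)) [⋀^Fin q]→L[ℝ] ℝ}
    (h : ∀ I : Fin q ↪o Fin n, A (basisTuple I) = B (basisTuple I)) : A = B := by
  apply ContinuousAlternatingMap.toAlternatingMap_injective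
  refine Module.Basis.ext_alternating (EuclideanSpace.basisFun (Fin n) ℝ).toBasis fun J hJ => ?_
  have key : ∀ C : (EuclideanSpace ℝ (Fin n)) [⋀^Fin q]→L[ℝ] ℝ,
      C.toAlternatingMap (fun i => (EuclideanSpace.basisFun (Fin n) ℝ).toBasis (J i)) =
        C (basisTuple J) := fun C => by
    simp
    rfl
  rw [key, key]
  -- Sorting an injective tuple makes it increasing; the sign of the sorting permutation is the same
  -- for both forms and cancels.
  have hmono : StrictMono (J ∘ Tuple.sort J) :=
    (Tuple.monotone_sort J).strictMono_of_injective (hJ.comp (Tuple.sort J).injective)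
  have hs := h (OrderEmbedding.ofStrictMono _ hmono)
  have hc : ∀ C : (EuclideanSpace ℝ (Fin n)) [⋀^Fin q]→L[ℝ] ℝ,
      C (basisTuple (OrderEmbedding.ofStrictMono _ hmono)) =
        Equiv.Perm.sign (Tuple.sort J) • C (basisTuple J) := fun C =>
    C.toAlternatingMap.map_perm (basisTuple J) (Tuple.sort J)
  rw [hc, hc] at hs
  exact (smul_right_injective _ (Equiv.Perm.sign (Tuple.sort J)).ne_zero) (by
    simpa [Units.smul_def] using hs)

/-- The elementary form `dx^I`. -/
def elemForm {n q : ℕ} (I : Fin q ↪o Fin n) : (EuclideanSpace ℝ (Fin n)) [⋀^Fin q]→L[ℝ] ℝ :=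
  { (Matrix.detRowAlternating (R := ℝ) (n := Fin q)).compLinearMap
      (LinearMap.pi fun b => (EuclideanSpace.proj (I b) :
        EuclideanSpace ℝ (Fin n) →L[ℝ] ℝ).toLinearMap) with
    cont := by
      change Continuous fun v : Fin q → EuclideanSpace ℝ (Fin n) =>
        Matrix.det (fun a b => v a (I b))
      apply Continuous.matrix_det
      fun_prop }

theorem elemForm_apply {n q : ℕ} (I : Fin q ↪o Fin n) (v : Fin q → EuclideanSpace ℝ (Fin n)) :
    elemForm I v = Matrix.det (fun a b => v a (I b)) := rfl

/-- Both ranges have q elements, so inclusion is equality, and an increasing enumeration is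
determined by its range. -/
theorem orderEmb_eq_of_range_subset {n q : ℕ} {I J : Fin q ↪o Fin n}
    (h : Set.range J ⊆ Set.range I) : J = I := by
  classical
  have hs : Finset.univ.map J.toEmbedding ⊆ Finset.univ.map I.toEmbedding := by
    intro x hx
    have : x ∈ Set.range J := by simpa using hx
    simpa using h this
  have := Finset.eq_of_subset_of_card_le hs (by simp)
  apply OrderEmbedding.range_inj.1
  ext x
  have := Finset.ext_iff.1 this x
  simpa using this

/-- If J ≠ I, some entry of J lies outside the range of I, and the corresponding row of the
determinant vanishes. -/
theorem elemForm_basisTuple {n q : ℕ} (I J : Fin q ↪o Fin n) :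
    elemForm I (basisTuple J) = if J = I then 1 else 0 := by
  rw [elemForm_apply]
  split_ifs with h
  · subst h
    rw [← Matrix.det_one (n := Fin q) (R := ℝ)]
    congr 1
    ext a b
    simp [basisTuple, Matrix.one_apply, eq_comm]
  · have : ¬ Set.range J ⊆ Set.range I := fun hs => h (orderEmb_eq_of_range_subset hs)
    obtain ⟨_, ⟨a, rfl⟩, ha⟩ := Set.not_subset.1 this
    apply Matrix.det_eq_zero_of_row_eq_zero a
    intro b
    have : I b ≠ J a := fun h => ha ⟨b, h⟩
    simp [basisTuple, this]

theorem alternating_eq_sum {n q : ℕ} (A : (EuclideanSpace ℝ (Fin n)) [⋀^Fin q]→L[ℝ] ℝ) :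
    A = ∑ I : Fin q ↪o Fin n, A (basisTuple I) • elemForm I := by
  apply alternating_ext_coeff
  intro J
  simp [ContinuousAlternatingMap.sum_apply, elemForm_basisTuple]

/-- Moving the k-th argument to the front takes k transpositions. This absorbs the signs of d into
contractions, so that later sums run over unordered pairs (j, K) without signs. -/
theorem neg_one_pow_mul_map_removeIndex {n q : ℕ}
    (A : (EuclideanSpace ℝ (Fin n)) [⋀^Fin (q + 1)]→L[ℝ] ℝ)
    (M : Fin (q + 1) ↪o Fin n) (k : Fin (q + 1)) :
    (-1) ^ (k : ℕ) * A (basisTuple M) =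
      A (basisTuple (Fin.cons (M k) (removeIndex M k) : Fin (q + 1) → Fin n)) := by
  have h := A.neg_one_pow_smul_map_insertNth k (basisTuple M k) (k.removeNth (basisTuple M))
  rw [Fin.insertNth_self_removeNth] at h
  rw [basisTuple_cons]
  rw [zsmul_eq_mul] at h
  push_cast at h
  exact h

/-- Pairs (increasing multi-index `M`, position `k`) correspond to pairs `(j, K)` with `j ∉ K`. -/
theorem sum_removeIndex {n q : ℕ} (G : Fin n → (Fin q ↪o Fin n) → ℝ)
    (hG : ∀ (j : Fin n) (K : Fin q ↪o Fin n), j ∈ Set.range K → G j K = 0) :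
    ∑ M : Fin (q + 1) ↪o Fin n, ∑ k : Fin (q + 1), G (M k) (removeIndex M k) =
      ∑ K : Fin q ↪o Fin n, ∑ j : Fin n, G j K := by
  classical
  rw [← Finset.sum_product', ← Finset.sum_product']
  have hrange : ∀ (M : Fin (q + 1) ↪o Fin n) k,
      Set.range M = insert (M k) (Set.range (removeIndex M k)) := by
    intro M k
    ext x
    simp only [Set.mem_range, Set.mem_insert_iff]
    constructor
    · rintro ⟨i, rfl⟩
      rcases Fin.eq_self_or_eq_succAbove k i with h | ⟨j, h⟩
      · left; rw [h]
      · right; exact ⟨j, by rw [h]; rfl⟩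
    · rintro (h | ⟨j, h⟩)
      · exact ⟨k, h.symm⟩
      · exact ⟨k.succAbove j, h⟩
  -- Removing the k-th entry is injective on pairs (M, k), since M is recovered from its range. The
  -- pairs (K, j) not reached are those with j in K, where `G` vanishes; for any other pair, M
  -- enumerates K ∪ {j}.
  refine Finset.sum_of_injOn (fun Mk => (removeIndex Mk.1 Mk.2, Mk.1 Mk.2)) ?_ ?_ ?_ ?_
  · rintro ⟨M, k⟩ - ⟨M', k'⟩ - h
    simp only [Prod.mk.injEq] at h
    have hM : M = M' := by
      apply orderEmb_eq_of_range_subset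
      rw [hrange M k, hrange M' k', h.1, h.2]
    subst hM
    simpa using h.2
  · intro _ _; simp
  · rintro ⟨K, j⟩ - hn
    apply hG
    by_contra hj
    apply hn
    have hcard : (insert j (Finset.univ.map K.toEmbedding)).card = q + 1 := by
      rw [Finset.card_insert_of_notMem]
      · simp
      · simpa using hj
    let M := (insert j (Finset.univ.map K.toEmbedding)).orderEmbOfFin hcard
    have hM : Set.range M = insert j (Set.range K) := by
      rw [Finset.range_orderEmbOfFin]
      ext; simp
    obtain ⟨k, hk⟩ : j ∈ Set.range M := by rw [hM]; simp
    refine ⟨(M, k), by simp, ?_⟩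
    simp only [Prod.mk.injEq]
    refine ⟨?_, hk⟩
    apply orderEmb_eq_of_range_subset
    rintro x ⟨i, rfl⟩
    have h1 : removeIndex M k i ∈ Set.range M := ⟨k.succAbove i, rfl⟩
    rw [hM] at h1
    rcases h1 with h1 | h1
    · exfalso
      rw [← hk] at h1
      exact Fin.succAbove_ne k i (M.injective h1)
    · exact h1
  · intro _ _; rfl

theorem map_basisTuple_cons_eq_zero {n q : ℕ}
    (A : (EuclideanSpace ℝ (Fin n)) [⋀^Fin (q + 1)]→L[ℝ] ℝ)
    {j : Fin n} {K : Fin q → Fin n} (h : j ∈ Set.range K) :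
    A (basisTuple (Fin.cons j K : Fin (q + 1) → Fin n)) = 0 := by
  apply map_basisTuple_eq_zero
  obtain ⟨i, hi⟩ := h
  intro hinj
  have := @hinj 0 i.succ (by simp [hi])
  exact (Fin.succ_ne_zero i) this.symm

/-- Adjointness of exterior and interior multiplication, with variable coefficients. -/
theorem sum_neg_one_pow_removeIndex {n q : ℕ}
    (U : Fin n → (Fin q ↪o Fin n) → ℝ)
    (B : Fin n → (EuclideanSpace ℝ (Fin n)) [⋀^Fin (q + 1)]→L[ℝ] ℝ) :
    ∑ M : Fin (q + 1) ↪o Fin n, ∑ k : Fin (q + 1),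
        (-1) ^ (k : ℕ) * (U (M k) (removeIndex M k) * B (M k) (basisTuple M)) =
      ∑ K : Fin q ↪o Fin n, ∑ j : Fin n,
        U j K * B j (basisTuple (Fin.cons j K : Fin (q + 1) → Fin n)) := by
  rw [← sum_removeIndex (fun j K => U j K * B j (basisTuple (Fin.cons j K : Fin (q + 1) → Fin n)))
    (fun j K h => by rw [map_basisTuple_cons_eq_zero _ h, mul_zero])]
  refine Finset.sum_congr rfl fun M _ => Finset.sum_congr rfl fun k _ => ?_
  rw [← neg_one_pow_mul_map_removeIndex]
  ring

/-- Each coefficient of a `(q+1)`-form is counted `q + 1` times by the contractions. -/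
theorem sum_sq_cons {n q : ℕ} (A : (EuclideanSpace ℝ (Fin n)) [⋀^Fin (q + 1)]→L[ℝ] ℝ) :
    ∑ K : Fin q ↪o Fin n, ∑ j : Fin n,
        A (basisTuple (Fin.cons j K : Fin (q + 1) → Fin n)) ^ 2 =
      ((q : ℝ) + 1) * ∑ M : Fin (q + 1) ↪o Fin n, A (basisTuple M) ^ 2 := by
  rw [← sum_removeIndex (fun j K => A (basisTuple (Fin.cons j K : Fin (q + 1) → Fin n)) ^ 2)
    (fun j K h => by rw [map_basisTuple_cons_eq_zero _ h]; simp), Finset.mul_sum]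
  refine Finset.sum_congr rfl fun M _ => ?_
  simp_rw [← neg_one_pow_mul_map_removeIndex, mul_pow, ← pow_mul, mul_comm _ 2, pow_mul]
  simp

/-- The pointwise Weitzenböck identity for the exterior derivative. -/
theorem sum_sq_alternatizeUncurryFin {n r : ℕ}
    (D : EuclideanSpace ℝ (Fin n) →L[ℝ] (EuclideanSpace ℝ (Fin n)) [⋀^Fin (r + 1)]→L[ℝ] ℝ) :
    ∑ M : Fin (r + 2) ↪o Fin n,
        (ContinuousAlternatingMap.alternatizeUncurryFin D (basisTuple M)) ^ 2 =
      ∑ K : Fin (r + 1) ↪o Fin n, ∑ j : Fin n,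
        (D (EuclideanSpace.single j 1) (basisTuple K)) ^ 2 -
      ∑ L : Fin r ↪o Fin n, ∑ i : Fin n, ∑ j : Fin n,
        D (EuclideanSpace.single j 1) (basisTuple (Fin.cons i L : Fin (r + 1) → Fin n)) *
        D (EuclideanSpace.single i 1) (basisTuple (Fin.cons j L : Fin (r + 1) → Fin n)) := by
  set E := ContinuousAlternatingMap.alternatizeUncurryFin D with hE
  -- Only one factor of the square is expanded; the other stays an alternating form, so that the
  -- adjointness of exterior multiplication and contraction applies.
  have h1 : ∀ M : Fin (r + 2) ↪o Fin n, E (basisTuple M) ^ 2 = ∑ k : Fin (r + 2),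
      (-1) ^ (k : ℕ) * (D (EuclideanSpace.single (M k) 1) (basisTuple (removeIndex M k)) *
        E (basisTuple M)) := by
    intro M
    conv_lhs => rw [pow_two]
    conv_lhs => enter [1]; rw [hE, ContinuousAlternatingMap.alternatizeUncurryFin_apply]
    rw [Finset.sum_mul]
    refine Finset.sum_congr rfl fun k _ => ?_
    rw [removeNth_basisTuple, removeNth_coe_orderEmb]
    simp only [basisTuple, zsmul_eq_mul]
    push_cast
    ring
  simp_rw [h1]
  rw [sum_neg_one_pow_removeIndex
    (fun j K => D (EuclideanSpace.single j 1) (basisTuple K)) (fun _ => E)]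
  -- With j in front, the term of the expansion that differentiates along e_j yields the squares;
  -- all others keep e_j as an argument and yield the cross terms.
  have h2 : ∀ (K : Fin (r + 1) ↪o Fin n) (j : Fin n),
      E (basisTuple (Fin.cons j K : Fin (r + 2) → Fin n)) =
        D (EuclideanSpace.single j 1) (basisTuple K) -
        ∑ k : Fin (r + 1), (-1) ^ (k : ℕ) * D (EuclideanSpace.single (K k) 1)
          (basisTuple (Fin.cons j (removeIndex K k) : Fin (r + 1) → Fin n)) := by
    intro K j
    rw [hE, ContinuousAlternatingMap.alternatizeUncurryFin_apply, Fin.sum_univ_succ,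
      sub_eq_add_neg, ← Finset.sum_neg_distrib]
    congr 1
    · simp [removeNth_basisTuple]
      simp [basisTuple]
    · refine Finset.sum_congr rfl fun k _ => ?_
      have : k.succ.removeNth (Fin.cons j K : Fin (r + 2) → Fin n) =
          Fin.cons j (removeIndex K k : Fin r → Fin n) := by
        funext i
        refine Fin.cases ?_ (fun i => ?_) i
        · simp [Fin.removeNth]
        · simp [Fin.removeNth]; rfl
      rw [removeNth_basisTuple, this]
      simp [basisTuple, pow_succ]
  simp_rw [h2, mul_sub, Finset.sum_sub_distrib, ← pow_two]
  congr 1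
  rw [Finset.sum_comm]
  -- The same adjointness, one degree lower and in the reverse direction: (K, k) becomes the pair
  -- (i, L) with i the entry removed from K.
  have h3 : ∀ j : Fin n, ∑ K : Fin (r + 1) ↪o Fin n,
      D (EuclideanSpace.single j 1) (basisTuple K) *
        ∑ k : Fin (r + 1), (-1) ^ (k : ℕ) * D (EuclideanSpace.single (K k) 1)
          (basisTuple (Fin.cons j (removeIndex K k) : Fin (r + 1) → Fin n)) =
      ∑ L : Fin r ↪o Fin n, ∑ i : Fin n,
        D (EuclideanSpace.single i 1) (basisTuple (Fin.cons j L : Fin (r + 1) → Fin n)) *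
        D (EuclideanSpace.single j 1) (basisTuple (Fin.cons i L : Fin (r + 1) → Fin n)) := by
    intro j
    rw [← sum_neg_one_pow_removeIndex (fun i L => D (EuclideanSpace.single i 1)
      (basisTuple (Fin.cons j L : Fin (r + 1) → Fin n))) (fun _ => D (EuclideanSpace.single j 1))]
    refine Finset.sum_congr rfl fun K _ => ?_
    rw [Finset.mul_sum]
    refine Finset.sum_congr rfl fun k _ => ?_
    ring
  simp_rw [h3]
  rw [Finset.sum_comm]

/-! ### Hilbert space duality -/

/-- A linear functional bounded by `M ‖A v‖` is represented by a vector of norm at most `M`. -/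
theorem exists_inner_eq_of_abs_le {V H : Type*} [AddCommGroup V] [Module ℝ V]
    [NormedAddCommGroup H] [InnerProductSpace ℝ H] [CompleteSpace H]
    (A : V →ₗ[ℝ] H) (B : V →ₗ[ℝ] ℝ) {C : ℝ} (hC : 0 ≤ C) (h : ∀ v, |B v| ≤ C * ‖A v‖) :
    ∃ u : H, ‖u‖ ≤ C ∧ ∀ v, inner ℝ u (A v) = B v := by
  -- The bound forces B to vanish where A does, so B descends to a functional on the range of A,
  -- bounded there by C.
  have hker : LinearMap.ker A ≤ LinearMap.ker B := by
    intro v hv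
    rw [LinearMap.mem_ker] at hv ⊢
    have := h v
    rw [hv, norm_zero, mul_zero] at this
    exact abs_nonpos_iff.1 this
  let ℓ : LinearMap.range A →ₗ[ℝ] ℝ :=
    ((LinearMap.ker A).liftQ B hker) ∘ₗ A.quotKerEquivRange.symm.toLinearMap
  have hℓ : ∀ v (hv : A v ∈ LinearMap.range A), ℓ ⟨A v, hv⟩ = B v := by
    intro v hv
    have : A.quotKerEquivRange.symm ⟨A v, hv⟩ = (LinearMap.ker A).mkQ v :=
      A.quotKerEquivRange_symm_apply_image v hv
    simp only [ℓ, LinearMap.comp_apply, LinearEquiv.coe_coe, this]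
    simp
  let L : StrongDual ℝ (LinearMap.range A) := ℓ.mkContinuous C (by
    rintro ⟨_, v, rfl⟩
    exact (congrArg norm (hℓ v (LinearMap.mem_range_self A v))).trans_le (h v))
  -- The range of A need not be closed: Hahn–Banach extends the functional to H without increasing
  -- its norm, and Riesz represents it.
  obtain ⟨g, hg, hgn⟩ := exists_extension_norm_eq (LinearMap.range A) L
  refine ⟨(InnerProductSpace.toDual ℝ H).symm g, ?_, fun v => ?_⟩
  · rw [LinearIsometryEquiv.norm_map, hgn]
    exact LinearMap.mkContinuous_norm_le _ hC _
  · rw [InnerProductSpace.toDual_symm_apply]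
    exact (hg ⟨A v, v, rfl⟩).trans (hℓ v _)

/-- Hörmander's duality argument: an a priori estimate on weakly closed vectors
yields a solution with the corresponding norm bound. -/
theorem exists_solution_of_estimate {V₁ V₂ H₁ H₂ : Type*}
    [AddCommGroup V₂] [Module ℝ V₂]
    [NormedAddCommGroup H₁] [InnerProductSpace ℝ H₁] [CompleteSpace H₁]
    [NormedAddCommGroup H₂] [InnerProductSpace ℝ H₂] [CompleteSpace H₂]
    (i₁ : V₁ → H₁) (d₁ : V₁ → H₂) (i₂ : V₂ →ₗ[ℝ] H₂) (δ : V₂ →ₗ[ℝ] H₁) (W : Set H₂)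
    {κ : ℝ} (hκ : 0 < κ)
    (hadj : ∀ α γ, inner ℝ (i₂ α) (d₁ γ) = inner ℝ (δ α) (i₁ γ))
    (hW : ∀ w ∈ W, ∀ γ, inner ℝ w (d₁ γ) = 0)
    (hest : ∀ (g : H₂) (s : H₁), (∀ w ∈ W, inner ℝ w g = 0) →
      (∀ γ, inner ℝ g (d₁ γ) = inner ℝ s (i₁ γ)) → κ * ‖g‖ ^ 2 ≤ ‖s‖ ^ 2)
    (f : H₂) (hf : ∀ w ∈ W, inner ℝ w f = 0) :
    ∃ u : H₁, (∀ α, inner ℝ u (δ α) = inner ℝ f (i₂ α)) ∧ ‖u‖ ^ 2 ≤ 1 / κ * ‖f‖ ^ 2 := by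
  -- This is the space of weakly closed vectors. It contains f by `hf` and every `d₁ γ` by `hW`.
  let N : Submodule ℝ H₂ := (Submodule.span ℝ W)ᗮ
  have hmem : ∀ v : H₂, (∀ w ∈ W, inner ℝ w v = 0) → v ∈ N := by
    intro v hv
    rw [Submodule.mem_orthogonal]
    intro w hw
    induction hw using Submodule.span_induction with
    | mem w hw => exact hv w hw
    | zero => simp
    | add a b _ _ ha hb => rw [inner_add_left, ha, hb, add_zero]
    | smul c a _ ha => rw [inner_smul_left, ha, mul_zero]
  have hproj : ∀ v y : H₂, y ∈ N → inner ℝ (N.starProjection v) y = inner ℝ v y := by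
    intro v y hy
    have := Submodule.starProjection_inner_eq_zero (K := N) v y hy
    rw [inner_sub_left] at this
    linarith
  have hbound : ∀ α, |(innerₛₗ ℝ f ∘ₗ i₂) α| ≤ ‖f‖ / √κ * ‖δ α‖ := by
    intro α
    -- The projection is in general no longer in the image of `i₂`, which is why `hest` concerns
    -- arbitrary vectors of H₂. Pairings with elements of N are unchanged by it: hence g still has
    -- weak adjoint image `δ α`, and ⟨f, g⟩ = ⟨f, i₂ α⟩.
    set g := N.starProjection (i₂ α) with hg
    have h1 : κ * ‖g‖ ^ 2 ≤ ‖δ α‖ ^ 2 := by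
      apply hest
      · intro w hw
        exact Submodule.inner_right_of_mem_orthogonal (Submodule.subset_span hw)
          (Submodule.starProjection_apply_mem N _)
      · intro γ
        rw [hproj _ _ (hmem _ fun w hw => hW w hw γ), hadj]
    have h2 : √κ * ‖g‖ ≤ ‖δ α‖ := by
      apply le_of_sq_le_sq _ (norm_nonneg _)
      rw [mul_pow, Real.sq_sqrt hκ.le]
      exact h1
    have h3 : (innerₛₗ ℝ f ∘ₗ i₂) α = inner ℝ f g := by
      rw [real_inner_comm, hproj _ _ (hmem f hf), real_inner_comm]
      rfl
    rw [h3]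
    have hs : 0 < √κ := Real.sqrt_pos.2 hκ
    calc |inner ℝ f g| ≤ ‖f‖ * ‖g‖ := abs_real_inner_le_norm f g
      _ ≤ ‖f‖ * (‖δ α‖ / √κ) := by
          gcongr
          rw [le_div_iff₀ hs]
          linarith
      _ = _ := by ring
  obtain ⟨u, hu, hur⟩ := exists_inner_eq_of_abs_le δ (innerₛₗ ℝ f ∘ₗ i₂) (by positivity) hbound
  refine ⟨u, hur, ?_⟩
  calc ‖u‖ ^ 2 ≤ (‖f‖ / √κ) ^ 2 := by gcongr
    _ = 1 / κ * ‖f‖ ^ 2 := by rw [div_pow, Real.sq_sqrt hκ.le]; ring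

/-! ### Calculus of partial derivatives and the commutator identity -/

section PartialDerivatives

variable {n : ℕ} {g h φ : EuclideanSpace ℝ (Fin n) → ℝ}

theorem ContDiff.pderiv (hg : ContDiff ℝ ∞ g) (j : Fin n) : ContDiff ℝ ∞ (pderiv j g) := by
  unfold _root_.pderiv
  exact (hg.fderiv_right (m := ∞) (by simp)).clm_apply contDiff_const

theorem HasCompactSupport.pderiv (hg : HasCompactSupport g) (j : Fin n) :
    HasCompactSupport (pderiv j g) :=
  hg.fderiv_apply (𝕜 := ℝ) _

theorem pderiv_add (hg : ContDiff ℝ ∞ g) (hh : ContDiff ℝ ∞ h) (j : Fin n)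
    (x : EuclideanSpace ℝ (Fin n)) :
    pderiv j (fun y => g y + h y) x = pderiv j g x + pderiv j h x := by
  unfold pderiv
  rw [fderiv_fun_add (hg.differentiable (by simp) x) (hh.differentiable (by simp) x)]
  rfl

theorem pderiv_sub (hg : ContDiff ℝ ∞ g) (hh : ContDiff ℝ ∞ h) (j : Fin n)
    (x : EuclideanSpace ℝ (Fin n)) :
    pderiv j (fun y => g y - h y) x = pderiv j g x - pderiv j h x := by
  unfold pderiv
  rw [fderiv_fun_sub (hg.differentiable (by simp) x) (hh.differentiable (by simp) x)]
  rfl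

theorem pderiv_mul (hg : ContDiff ℝ ∞ g) (hh : ContDiff ℝ ∞ h) (j : Fin n)
    (x : EuclideanSpace ℝ (Fin n)) :
    pderiv j (fun y => g y * h y) x = pderiv j g x * h x + g x * pderiv j h x := by
  unfold pderiv
  rw [fderiv_fun_mul (hg.differentiable (by simp) x) (hh.differentiable (by simp) x)]
  simp
  ring

theorem pderiv_const_mul (hg : ContDiff ℝ ∞ g) (c : ℝ) (j : Fin n)
    (x : EuclideanSpace ℝ (Fin n)) :
    pderiv j (fun y => c * g y) x = c * pderiv j g x := by
  rw [pderiv_mul contDiff_const hg]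
  simp [pderiv]

theorem pderiv_exp_neg (hφ : ContDiff ℝ ∞ φ) (j : Fin n) (x : EuclideanSpace ℝ (Fin n)) :
    pderiv j (fun y => Real.exp (-φ y)) x = -(Real.exp (-φ x) * pderiv j φ x) := by
  unfold pderiv
  rw [fderiv_exp (hφ.differentiable (by simp) x).fun_neg, fderiv_fun_neg]
  simp

theorem pderiv_exp (hφ : ContDiff ℝ ∞ φ) (j : Fin n) (x : EuclideanSpace ℝ (Fin n)) :
    pderiv j (fun y => Real.exp (φ y)) x = Real.exp (φ x) * pderiv j φ x := by
  unfold pderiv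
  rw [fderiv_exp (hφ.differentiable (by simp) x)]
  simp

theorem pderiv_comm (hg : ContDiff ℝ ∞ g) (j k : Fin n) (x : EuclideanSpace ℝ (Fin n)) :
    pderiv j (pderiv k g) x = pderiv k (pderiv j g) x := by
  have hd : DifferentiableAt ℝ (fderiv ℝ g) x :=
    (hg.fderiv_right (m := ∞) (by simp)).differentiable (by simp) x
  have key : ∀ a b : Fin n, pderiv a (pderiv b g) x =
      fderiv ℝ (fderiv ℝ g) x (EuclideanSpace.single a 1) (EuclideanSpace.single b 1) := by
    intro a b
    unfold pderiv
    rw [fderiv_clm_apply hd (differentiableAt_const _)]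
    simp
  rw [key, key]
  have hs : IsSymmSndFDerivAt ℝ g x := hg.contDiffAt.isSymmSndFDerivAt (by
    rw [minSmoothness_of_isRCLikeNormedField]; exact WithTop.coe_le_coe.2 le_top)
  exact hs _ _

/-- Integration by parts against the constant function 1. -/
theorem integral_pderiv_eq_zero (hg : ContDiff ℝ ∞ g) (hc : HasCompactSupport g) (j : Fin n) :
    ∫ x, pderiv j g x = 0 := by
  have h1 : Integrable (pderiv j g) :=
    (hg.pderiv j).continuous.integrable_of_hasCompactSupport (hc.pderiv j)
  have h2 : Integrable g := hg.continuous.integrable_of_hasCompactSupport hc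
  have := integral_mul_fderiv_eq_neg_fderiv_mul_of_integrable (𝕜 := ℝ) (μ := volume)
    (f := fun _ : EuclideanSpace ℝ (Fin n) => (1 : ℝ)) (g := g)
    (v := EuclideanSpace.single j 1) (by simp) (by simp only [one_mul]; exact h1)
    (by simpa using h2) (fun _ _ => differentiableAt_const _)
    (fun x _ => hg.differentiable (by simp) x)
  simpa [pderiv] using this

/-- The commutator identity `[∂_i, δ_j] = -∂_i∂_jφ`, in integrated form. -/
theorem integral_commutator_eq_zero (hφ : ContDiff ℝ ∞ φ) (hg : ContDiff ℝ ∞ g)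
    (hgc : HasCompactSupport g) (hh : ContDiff ℝ ∞ h) (i j : Fin n) :
    ∫ x, ((pderiv i g x - pderiv i φ x * g x) * (pderiv j h x - pderiv j φ x * h x) -
      pderiv j g x * pderiv i h x - pderiv i (pderiv j φ) x * g x * h x) * Real.exp (-φ x) = 0 := by
  have hw : ContDiff ℝ ∞ fun x => Real.exp (-φ x) := hφ.neg.exp
  have hδ : ContDiff ℝ ∞ fun x => pderiv j h x - pderiv j φ x * h x :=
    (hh.pderiv j).sub ((hφ.pderiv j).mul hh)
  have h1 : ContDiff ℝ ∞ fun x =>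
      Real.exp (-φ x) * (g x * (pderiv j h x - pderiv j φ x * h x)) := hw.mul (hg.mul hδ)
  have h2 : ContDiff ℝ ∞ fun x => Real.exp (-φ x) * (g x * pderiv i h x) :=
    hw.mul (hg.mul (hh.pderiv i))
  have c1 : HasCompactSupport fun x =>
      Real.exp (-φ x) * (g x * (pderiv j h x - pderiv j φ x * h x)) := hgc.mul_right.mul_left
  have c2 : HasCompactSupport fun x => Real.exp (-φ x) * (g x * pderiv i h x) :=
    hgc.mul_right.mul_left
  -- The integrand is a difference of two derivatives of compactly supported functions: the second
  -- derivatives of h cancel by symmetry, and ∂_i∂_jφ remains from differentiating the factor ∂_jφ.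
  -- Compact support of g alone suffices.
  have e : ∀ x, ((pderiv i g x - pderiv i φ x * g x) * (pderiv j h x - pderiv j φ x * h x) -
      pderiv j g x * pderiv i h x - pderiv i (pderiv j φ) x * g x * h x) * Real.exp (-φ x) =
      pderiv i (fun x => Real.exp (-φ x) * (g x * (pderiv j h x - pderiv j φ x * h x))) x -
      pderiv j (fun x => Real.exp (-φ x) * (g x * pderiv i h x)) x := by
    intro x
    rw [pderiv_mul hw (hg.mul hδ), pderiv_mul hg hδ, pderiv_sub (hh.pderiv j)
      ((hφ.pderiv j).mul hh), pderiv_mul (hφ.pderiv j) hh, pderiv_mul hw (hg.mul (hh.pderiv i)),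
      pderiv_mul hg (hh.pderiv i), pderiv_exp_neg hφ, pderiv_exp_neg hφ, pderiv_comm hh i j]
    ring
  simp_rw [e]
  rw [integral_sub, integral_pderiv_eq_zero h1 c1, integral_pderiv_eq_zero h2 c2, sub_zero]
  · exact (h1.pderiv i).continuous.integrable_of_hasCompactSupport (c1.pderiv i)
  · exact (h2.pderiv j).continuous.integrable_of_hasCompactSupport (c2.pderiv j)

end PartialDerivatives

/-! ### Smooth forms, the weighted codifferential and the Bochner inequality -/

section Forms

variable {n : ℕ} {φ : EuclideanSpace ℝ (Fin n) → ℝ}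

theorem ContDiff.alternating_apply {q : ℕ} {α : DForm n q} (hα : ContDiff ℝ ∞ α)
    (v : Fin q → EuclideanSpace ℝ (Fin n)) : ContDiff ℝ ∞ fun x => α x v :=
  (ContinuousAlternatingMap.apply ℝ (EuclideanSpace ℝ (Fin n)) ℝ v).contDiff.comp hα

theorem HasCompactSupport.alternating_apply {q : ℕ} {α : DForm n q} (hα : HasCompactSupport α)
    (v : Fin q → EuclideanSpace ℝ (Fin n)) : HasCompactSupport fun x => α x v :=
  hα.comp_left (g := fun A : (EuclideanSpace ℝ (Fin n)) [⋀^Fin q]→L[ℝ] ℝ => A v) rfl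

theorem pderiv_alternating_apply {q : ℕ} {α : DForm n q} (hα : ContDiff ℝ ∞ α)
    (v : Fin q → EuclideanSpace ℝ (Fin n)) (j : Fin n) (x : EuclideanSpace ℝ (Fin n)) :
    pderiv j (fun y => α y v) x = fderiv ℝ α x (EuclideanSpace.single j 1) v := by
  have h := ((ContinuousAlternatingMap.apply ℝ (EuclideanSpace ℝ (Fin n)) ℝ v).hasFDerivAt
    (x := α x)).comp x (hα.differentiable (by simp) x).hasFDerivAt
  unfold pderiv
  rw [show (fun y => α y v) =
    ContinuousAlternatingMap.apply ℝ (EuclideanSpace ℝ (Fin n)) ℝ v ∘ α from rfl, h.fderiv]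
  rfl

/-- The coefficients of the exterior derivative of a smooth form. -/
theorem extDeriv_basisTuple {q : ℕ} {α : DForm n q} (hα : ContDiff ℝ ∞ α)
    (M : Fin (q + 1) ↪o Fin n) (x : EuclideanSpace ℝ (Fin n)) :
    extDeriv α x (basisTuple M) =
      ∑ k : Fin (q + 1), (-1) ^ (k : ℕ) *
        pderiv (M k) (fun y => α y (basisTuple (removeIndex M k))) x := by
  rw [extDeriv, ContinuousAlternatingMap.alternatizeUncurryFin_apply]
  refine Finset.sum_congr rfl fun k _ => ?_
  rw [removeNth_basisTuple, removeNth_coe_orderEmb, pderiv_alternating_apply hα, zsmul_eq_mul]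
  push_cast
  rfl

theorem ContDiff.extDeriv {q : ℕ} {α : DForm n q} (hα : ContDiff ℝ ∞ α) :
    ContDiff ℝ ∞ (extDeriv α) := by
  have h : ContDiff ℝ ∞ (fderiv ℝ α) := hα.fderiv_right (m := ∞) (by simp)
  have e : _root_.extDeriv α = fun x => ContinuousAlternatingMap.alternatizeUncurryFinCLM (n := q) ℝ
      (EuclideanSpace ℝ (Fin n)) ℝ (fderiv ℝ α x) := rfl
  rw [e]
  exact (ContinuousLinearMap.contDiff _).comp h

theorem HasCompactSupport.extDeriv {q : ℕ} {α : DForm n q} (hα : HasCompactSupport α) :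
    HasCompactSupport (extDeriv α) := by
  have e : _root_.extDeriv α = ContinuousAlternatingMap.alternatizeUncurryFinCLM (n := q) ℝ
      (EuclideanSpace ℝ (Fin n)) ℝ ∘ fderiv ℝ α := rfl
  rw [e]
  exact (hα.fderiv (𝕜 := ℝ)).comp_left (map_zero _)

theorem DForm.isTest_extDeriv {q : ℕ} {α : DForm n q} (hα : α.IsTest) :
    DForm.IsTest (n := n) (p := q + 1) (_root_.extDeriv α) :=
  ⟨ContDiff.extDeriv hα.smooth, HasCompactSupport.extDeriv hα.compact⟩

theorem DForm.IsTest.smul {q : ℕ} {α : DForm n q} (hα : α.IsTest)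
    {η : EuclideanSpace ℝ (Fin n) → ℝ} (hη : ContDiff ℝ ∞ η) :
    DForm.IsTest (n := n) (p := q) (fun x => η x • α x) where
  smooth := hη.smul hα.smooth
  compact := HasCompactSupport.smul_left (f := η) (f' := α) hα.compact

theorem DForm.isTest_smul_const {q : ℕ} {η : EuclideanSpace ℝ (Fin n) → ℝ}
    (hη : ContDiff ℝ ∞ η) (hc : HasCompactSupport η)
    (A : (EuclideanSpace ℝ (Fin n)) [⋀^Fin q]→L[ℝ] ℝ) :
    DForm.IsTest (n := n) (p := q) (fun x => η x • A) where
  smooth := hη.smul contDiff_const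
  compact := hc.smul_right

/-- The coefficient at `K` of the formal adjoint of `d` in `L²(e^{-φ})`. -/
def codiff {q : ℕ} (φ : EuclideanSpace ℝ (Fin n) → ℝ) (β : DForm n (q + 1)) (K : Fin q ↪o Fin n)
    (x : EuclideanSpace ℝ (Fin n)) : ℝ :=
  -(Real.exp (φ x) * ∑ j : Fin n, pderiv j (fun y => Real.exp (-φ y) *
    β y (basisTuple (Fin.cons j K : Fin (q + 1) → Fin n))) x)

/-- Differentiating the weight cancels the exponentials and leaves -∑(∂_j - ∂_jφ), the form in which
linearity is visible and the square can be expanded. -/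
theorem codiff_eq {q : ℕ} (hφ : ContDiff ℝ ∞ φ) {β : DForm n (q + 1)} (hβ : ContDiff ℝ ∞ β)
    (K : Fin q ↪o Fin n) (x : EuclideanSpace ℝ (Fin n)) :
    codiff φ β K x = -∑ j : Fin n,
      (pderiv j (fun y => β y (basisTuple (Fin.cons j K : Fin (q + 1) → Fin n))) x -
        pderiv j φ x * β x (basisTuple (Fin.cons j K : Fin (q + 1) → Fin n))) := by
  rw [codiff, Finset.mul_sum]
  congr 1
  refine Finset.sum_congr rfl fun j _ => ?_
  rw [pderiv_mul hφ.neg.exp (hβ.alternating_apply _), pderiv_exp_neg hφ]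
  have : Real.exp (φ x) * Real.exp (-φ x) = 1 := by rw [← Real.exp_add]; simp
  linear_combination (pderiv j (fun y => β y (basisTuple (Fin.cons j K : Fin (q + 1) → Fin n))) x -
        pderiv j φ x * β x (basisTuple (Fin.cons j K : Fin (q + 1) → Fin n))) * this

theorem contDiff_codiff {q : ℕ} (hφ : ContDiff ℝ ∞ φ) {β : DForm n (q + 1)} (hβ : ContDiff ℝ ∞ β)
    (K : Fin q ↪o Fin n) : ContDiff ℝ ∞ (codiff φ β K) := by
  unfold codiff
  refine (hφ.exp.mul (ContDiff.sum fun j _ => ?_)).neg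
  exact (hφ.neg.exp.mul (hβ.alternating_apply _)).pderiv j

theorem hasCompactSupport_finset_sum {ι X : Type*} [TopologicalSpace X] (s : Finset ι)
    {F : ι → X → ℝ} (hF : ∀ i ∈ s, HasCompactSupport (F i)) :
    HasCompactSupport fun x => ∑ i ∈ s, F i x := by
  classical
  induction s using Finset.induction_on with
  | empty => simpa using! (HasCompactSupport.zero : HasCompactSupport (0 : X → ℝ))
  | insert a s ha ih =>
    simp only [Finset.sum_insert ha]
    exact (hF a (by simp)).add (ih fun i hi => hF i (by simp [hi]))

theorem hasCompactSupport_codiff {q : ℕ} {β : DForm n (q + 1)} (hβ : HasCompactSupport β)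
    (K : Fin q ↪o Fin n) : HasCompactSupport (codiff φ β K) := by
  have h : HasCompactSupport fun x => ∑ j : Fin n, pderiv j (fun y => Real.exp (-φ y) *
      β y (basisTuple (Fin.cons j K : Fin (q + 1) → Fin n))) x :=
    hasCompactSupport_finset_sum _ fun j _ =>
      HasCompactSupport.pderiv (hβ.alternating_apply _).mul_left j
  exact HasCompactSupport.comp_left (g := fun t : ℝ => -t) h.mul_left neg_zero

/-- The coefficient-wise formula for the distributional exterior derivative as a divergence. -/
theorem sum_weakDCoeff {q : ℕ} {u : DForm n q}
    (hu : ∀ I : Fin q ↪o Fin n, LocallyIntegrable (u.coeff I))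
    {α : DForm n (q + 1)} (hα : α.IsTest) :
    ∑ M : Fin (q + 1) ↪o Fin n, u.weakDCoeff M (α.coeff M) =
      -∫ x, ∑ K : Fin q ↪o Fin n, u.coeff K x * ∑ j : Fin n,
        pderiv j (fun y => α y (basisTuple (Fin.cons j K : Fin (q + 1) → Fin n))) x := by
  have hsm : ∀ M : Fin (q + 1) ↪o Fin n, ContDiff ℝ ∞ (α.coeff M) := fun M =>
    hα.smooth.alternating_apply _
  have hcs : ∀ M : Fin (q + 1) ↪o Fin n, HasCompactSupport (α.coeff M) := fun M =>
    hα.compact.alternating_apply _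
  have hint : ∀ (M : Fin (q + 1) ↪o Fin n) k, Integrable fun x =>
      u.coeff (removeIndex M k) x * pderiv (M k) (α.coeff M) x := by
    intro M k
    have := (hu (removeIndex M k)).integrable_smul_left_of_hasCompactSupport
      ((hsm M).pderiv (M k)).continuous ((hcs M).pderiv (M k))
    simpa [mul_comm] using this
  unfold DForm.weakDCoeff
  -- Adjointness with a different form ∂_jα for each direction j; the factor u_K does not depend on
  -- j.
  have h1 : ∀ x, ∑ K : Fin q ↪o Fin n, u.coeff K x * ∑ j : Fin n,
        pderiv j (fun y => α y (basisTuple (Fin.cons j K : Fin (q + 1) → Fin n))) x =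
      ∑ M : Fin (q + 1) ↪o Fin n, ∑ k : Fin (q + 1), (-1) ^ (k : ℕ) *
        (u.coeff (removeIndex M k) x * pderiv (M k) (α.coeff M) x) := by
    intro x
    have := sum_neg_one_pow_removeIndex (fun _ K => u.coeff K x)
      (fun j => fderiv ℝ α x (EuclideanSpace.single j 1))
    simp_rw [← pderiv_alternating_apply hα.smooth] at this
    simp_rw [Finset.mul_sum]
    exact this.symm
  simp_rw [h1]
  rw [integral_finsetSum _ fun M _ => integrable_finsetSum _ fun k _ => (hint M k).const_mul _,
    ← Finset.sum_neg_distrib]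
  refine Finset.sum_congr rfl fun M _ => ?_
  rw [integral_finsetSum _ fun k _ => (hint M k).const_mul _, ← Finset.sum_neg_distrib]
  refine Finset.sum_congr rfl fun k _ => ?_
  rw [integral_const_mul]
  ring

/-- Pointwise adjointness of the exterior derivative and contraction. -/
theorem sum_mul_extDeriv {q : ℕ} (A : (EuclideanSpace ℝ (Fin n)) [⋀^Fin (q + 1)]→L[ℝ] ℝ)
    {γ : DForm n q} (hγ : ContDiff ℝ ∞ γ) (x : EuclideanSpace ℝ (Fin n)) :
    ∑ M : Fin (q + 1) ↪o Fin n, A (basisTuple M) * extDeriv γ x (basisTuple M) =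
      ∑ K : Fin q ↪o Fin n, ∑ j : Fin n, pderiv j (fun y => γ y (basisTuple K)) x *
        A (basisTuple (Fin.cons j K : Fin (q + 1) → Fin n)) := by
  rw [← sum_neg_one_pow_removeIndex (fun j K => pderiv j (fun y => γ y (basisTuple K)) x)
    (fun _ => A)]
  refine Finset.sum_congr rfl fun M _ => ?_
  rw [extDeriv_basisTuple hγ, Finset.mul_sum]
  refine Finset.sum_congr rfl fun k _ => ?_
  ring

/-- `codiff φ` is the formal adjoint of `d` in `L²(e^{-φ})`. -/
theorem integral_codiff_mul {q : ℕ} (hφ : ContDiff ℝ ∞ φ) {β : DForm n (q + 1)} (hβ : β.IsTest)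
    {γ : DForm n q} (hγ : ContDiff ℝ ∞ γ) :
    ∫ x, (∑ M : Fin (q + 1) ↪o Fin n, β x (basisTuple M) * extDeriv γ x (basisTuple M)) *
        Real.exp (-φ x) =
      ∫ x, (∑ K : Fin q ↪o Fin n, codiff φ β K x * γ x (basisTuple K)) * Real.exp (-φ x) := by
  have hw : ContDiff ℝ ∞ fun x => Real.exp (-φ x) := hφ.neg.exp
  have hb : ∀ v, ContDiff ℝ ∞ fun y => Real.exp (-φ y) * β y v := fun v =>
    hw.mul (hβ.smooth.alternating_apply v)
  have hbc : ∀ v, HasCompactSupport fun y => Real.exp (-φ y) * β y v := fun v =>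
    (hβ.compact.alternating_apply v).mul_left
  have hg : ∀ v, ContDiff ℝ ∞ fun y => γ y v := fun v => hγ.alternating_apply v
  have hp : ∀ (j : Fin n) v v', ContDiff ℝ ∞ fun y => (Real.exp (-φ y) * β y v) * γ y v' :=
    fun j v v' => (hb v).mul (hg v')
  -- The two integrands differ by a divergence of products containing a coefficient of β, so no
  -- compact support of γ is needed for the integral to vanish.
  have key : ∀ x, (∑ M : Fin (q + 1) ↪o Fin n, β x (basisTuple M) * extDeriv γ x (basisTuple M)) *
        Real.exp (-φ x) -
      (∑ K : Fin q ↪o Fin n, codiff φ β K x * γ x (basisTuple K)) * Real.exp (-φ x) =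
      ∑ K : Fin q ↪o Fin n, ∑ j : Fin n, pderiv j (fun y => (Real.exp (-φ y) *
        β y (basisTuple (Fin.cons j K : Fin (q + 1) → Fin n))) * γ y (basisTuple K)) x := by
    intro x
    rw [sum_mul_extDeriv _ hγ, Finset.sum_mul, Finset.sum_mul, ← Finset.sum_sub_distrib]
    refine Finset.sum_congr rfl fun K _ => ?_
    rw [codiff, Finset.sum_mul]
    have h3 : -(Real.exp (φ x) * ∑ j : Fin n, pderiv j (fun y => Real.exp (-φ y) *
        β y (basisTuple (Fin.cons j K : Fin (q + 1) → Fin n))) x) * γ x (basisTuple K) *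
        Real.exp (-φ x) = -∑ j : Fin n, pderiv j (fun y => Real.exp (-φ y) *
        β y (basisTuple (Fin.cons j K : Fin (q + 1) → Fin n))) x * γ x (basisTuple K) := by
      rw [← Finset.sum_mul]
      have : Real.exp (φ x) * Real.exp (-φ x) = 1 := by rw [← Real.exp_add]; simp
      linear_combination (-(∑ j : Fin n, pderiv j (fun y => Real.exp (-φ y) *
        β y (basisTuple (Fin.cons j K : Fin (q + 1) → Fin n))) x) * γ x (basisTuple K)) * this
    rw [h3, sub_neg_eq_add, ← Finset.sum_add_distrib]
    refine Finset.sum_congr rfl fun j _ => ?_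
    rw [pderiv_mul (hb _) (hg _)]
    ring
  have i1 : Integrable fun x => (∑ M : Fin (q + 1) ↪o Fin n, β x (basisTuple M) *
      extDeriv γ x (basisTuple M)) * Real.exp (-φ x) := by
    refine Continuous.integrable_of_hasCompactSupport ?_ ?_
    · refine Continuous.mul (continuous_finsetSum _ fun M _ => ?_) hw.continuous
      exact (hβ.smooth.alternating_apply _).continuous.mul
        (ContDiff.alternating_apply (n := n) (q := q + 1) hγ.extDeriv _).continuous
    · refine HasCompactSupport.mul_right (hasCompactSupport_finset_sum _ fun M _ => ?_)
      exact (hβ.compact.alternating_apply _).mul_right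
  have i2 : Integrable fun x => (∑ K : Fin q ↪o Fin n, codiff φ β K x * γ x (basisTuple K)) *
      Real.exp (-φ x) := by
    refine Continuous.integrable_of_hasCompactSupport ?_ ?_
    · refine Continuous.mul (continuous_finsetSum _ fun M _ => ?_) hw.continuous
      exact (contDiff_codiff hφ hβ.smooth _).continuous.mul (hg _).continuous
    · refine HasCompactSupport.mul_right (hasCompactSupport_finset_sum _ fun M _ => ?_)
      exact (hasCompactSupport_codiff hβ.compact _).mul_right
  rw [← sub_eq_zero, ← integral_sub i1 i2]
  simp_rw [key]
  have i3 : ∀ (K : Fin q ↪o Fin n) (j : Fin n), Integrable (pderiv j fun y => (Real.exp (-φ y) *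
        β y (basisTuple (Fin.cons j K : Fin (q + 1) → Fin n))) * γ y (basisTuple K)) := fun K j =>
    ((hp j _ _).pderiv j).continuous.integrable_of_hasCompactSupport
      (HasCompactSupport.pderiv (hbc _).mul_right j)
  rw [integral_finsetSum _ fun K _ => integrable_finsetSum _ fun j _ => i3 K j]
  refine Finset.sum_eq_zero fun K _ => ?_
  rw [integral_finsetSum _ fun j _ => i3 K j]
  refine Finset.sum_eq_zero fun j _ => ?_
  exact integral_pderiv_eq_zero (hp j _ _) (hbc _).mul_right j

/-- The Bochner–Kohn–Hörmander inequality for test forms. -/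
theorem bochner_inequality {r : ℕ} (hφ : ContDiff ℝ ∞ φ) {c : ℝ}
    (hconv : ∀ x w : EuclideanSpace ℝ (Fin n),
      c * ‖w‖ ^ 2 ≤ ∑ j : Fin n, ∑ k : Fin n, pderiv j (pderiv k φ) x * w j * w k)
    {α : DForm n (r + 1)} (hα : α.IsTest) :
    c * ((r : ℝ) + 1) * ∫ x, (∑ M : Fin (r + 1) ↪o Fin n, α x (basisTuple M) ^ 2) *
        Real.exp (-φ x) ≤
      (∫ x, (∑ K : Fin r ↪o Fin n, codiff φ α K x ^ 2) * Real.exp (-φ x)) +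
      ∫ x, (∑ M : Fin (r + 2) ↪o Fin n, extDeriv α x (basisTuple M) ^ 2) * Real.exp (-φ x) := by
  have hw : ContDiff ℝ ∞ fun x => Real.exp (-φ x) := hφ.neg.exp
  have ha : ∀ v, ContDiff ℝ ∞ fun y => α y v := fun v => hα.smooth.alternating_apply v
  have hac : ∀ v, HasCompactSupport fun y => α y v := fun v => hα.compact.alternating_apply v
  have hd : ∀ v, ContDiff ℝ ∞ fun y => extDeriv α y v := fun v =>
    (DForm.isTest_extDeriv hα).smooth.alternating_apply v
  have hdc : ∀ v, HasCompactSupport fun y => extDeriv α y v := fun v =>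
    (DForm.isTest_extDeriv hα).compact.alternating_apply v
  have hint : ∀ (ι : Type) [Fintype ι] (F : ι → EuclideanSpace ℝ (Fin n) → ℝ),
      (∀ i, ContDiff ℝ ∞ (F i)) → (∀ i, HasCompactSupport (F i)) →
      Integrable fun x => (∑ i, F i x ^ 2) * Real.exp (-φ x) := by
    intro ι _ F h1 h2
    refine Continuous.integrable_of_hasCompactSupport ?_ ?_
    · exact (continuous_finsetSum _ fun i _ => (h1 i).continuous.pow 2).mul hw.continuous
    · refine HasCompactSupport.mul_right (hasCompactSupport_finset_sum _ fun i _ => ?_)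
      exact (h2 i).comp_left (g := fun t => t ^ 2) (by simp)
  have i1 := hint _ (fun (M : Fin (r + 1) ↪o Fin n) x => α x (basisTuple M))
    (fun M => ha _) (fun M => hac _)
  have i2 := hint _ (fun (K : Fin r ↪o Fin n) x => codiff φ α K x)
    (fun K => contDiff_codiff hφ hα.smooth K) (fun K => hasCompactSupport_codiff hα.compact K)
  have i3 := hint _ (fun (M : Fin (r + 2) ↪o Fin n) x => extDeriv α x (basisTuple M))
    (fun M => hd _) (fun M => hdc _)
  let a : (Fin r ↪o Fin n) → Fin n → EuclideanSpace ℝ (Fin n) → ℝ := fun L i x =>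
    α x (basisTuple (Fin.cons i L : Fin (r + 1) → Fin n))
  -- For fixed L, the commutator integrand for the contracted coefficients a_i = α(e_i, e_L) and
  -- a_j. Summed over L, i, j it gives |δα|² minus the cross terms minus the Hessian term, times the
  -- weight.
  let T : (Fin r ↪o Fin n) → Fin n → Fin n → EuclideanSpace ℝ (Fin n) → ℝ := fun L i j x =>
    ((pderiv i (a L i) x - pderiv i φ x * a L i x) * (pderiv j (a L j) x - pderiv j φ x * a L j x) -
      pderiv j (a L i) x * pderiv i (a L j) x - pderiv i (pderiv j φ) x * a L i x * a L j x) *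
      Real.exp (-φ x)
  have hT : ∀ L i j, ∫ x, T L i j x = 0 := fun L i j =>
    integral_commutator_eq_zero hφ (ha _) (hac _) (ha _) i j
  have iT : ∀ L i j, Integrable (T L i j) := by
    intro L i j
    have s1 : ∀ i, ContDiff ℝ ∞ (a L i) := fun i => ha _
    have s2 : ∀ i, HasCompactSupport (a L i) := fun i => hac _
    refine Continuous.integrable_of_hasCompactSupport ?_ ?_
    · have t1 : ∀ i j, Continuous (pderiv i (a L j)) := fun i j => ((s1 j).pderiv i).continuous
      have t2 : ∀ i, Continuous (pderiv i φ) := fun i => (hφ.pderiv i).continuous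
      have t3 : ∀ i j, Continuous (pderiv i (pderiv j φ)) := fun i j =>
        ((hφ.pderiv j).pderiv i).continuous
      have t4 : ∀ i, Continuous (a L i) := fun i => (s1 i).continuous
      exact Continuous.mul (by fun_prop) hw.continuous
    · refine HasCompactSupport.mul_right ?_
      refine HasCompactSupport.sub (HasCompactSupport.sub (HasCompactSupport.mul_right ?_) ?_) ?_
      · exact ((s2 i).pderiv i).sub (s2 i).mul_left
      · exact ((s2 i).pderiv j).mul_right
      · exact HasCompactSupport.mul_right (s2 i).mul_left
  have hsum : ∫ x, ∑ L : Fin r ↪o Fin n, ∑ i : Fin n, ∑ j : Fin n, T L i j x = 0 := by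
    rw [integral_finsetSum _ fun L _ => integrable_finsetSum _ fun i _ =>
      integrable_finsetSum _ fun j _ => iT L i j]
    refine Finset.sum_eq_zero fun L _ => ?_
    rw [integral_finsetSum _ fun i _ => integrable_finsetSum _ fun j _ => iT L i j]
    refine Finset.sum_eq_zero fun i _ => ?_
    rw [integral_finsetSum _ fun j _ => iT L i j]
    exact Finset.sum_eq_zero fun j _ => hT L i j
  have i23 : Integrable fun x => (∑ K : Fin r ↪o Fin n, codiff φ α K x ^ 2) * Real.exp (-φ x) +
      (∑ M : Fin (r + 2) ↪o Fin n, extDeriv α x (basisTuple M) ^ 2) * Real.exp (-φ x) := i2.add i3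
  -- Replacing 0 by the vanishing integral of ∑ `T` leaves a pointwise inequality between
  -- integrands.
  rw [← integral_const_mul, ← integral_add i2 i3, ← sub_nonneg,
    ← integral_sub i23 (i1.const_mul _), ← hsum]
  refine integral_mono (integrable_finsetSum _ fun L _ => integrable_finsetSum _ fun i _ =>
      integrable_finsetSum _ fun j _ => iT L i j) (i23.sub (i1.const_mul _)) fun x => ?_
  have e1 : ∀ K : Fin r ↪o Fin n, codiff φ α K x ^ 2 = ∑ i : Fin n, ∑ j : Fin n,
      (pderiv i (a K i) x - pderiv i φ x * a K i x) *
        (pderiv j (a K j) x - pderiv j φ x * a K j x) := by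
    intro K
    rw [codiff_eq hφ hα.smooth, neg_sq, pow_two, Finset.sum_mul_sum]
  -- The Weitzenböck identity gives |dα|² as the full gradient squared (`e3`, discarded) minus
  -- exactly the cross terms that occur in ∑ `T`.
  have e2 := sum_sq_alternatizeUncurryFin (fderiv ℝ α x)
  simp_rw [← pderiv_alternating_apply hα.smooth] at e2
  have e3 : 0 ≤ ∑ K : Fin (r + 1) ↪o Fin n, ∑ j : Fin n,
      pderiv j (fun y => α y (basisTuple K)) x ^ 2 :=
    Finset.sum_nonneg fun K _ => Finset.sum_nonneg fun j _ => sq_nonneg _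
  have e4 := sum_sq_cons (α x)
  have e5 : c * ∑ K : Fin r ↪o Fin n, ∑ j : Fin n, a K j x ^ 2 ≤
      ∑ K : Fin r ↪o Fin n, ∑ i : Fin n, ∑ j : Fin n,
        pderiv i (pderiv j φ) x * a K i x * a K j x := by
    rw [Finset.mul_sum]
    refine Finset.sum_le_sum fun K _ => ?_
    -- Convexity is applied, for each K, to the vector of contractions (α(e_j, e_K))_j; `e4` then
    -- turns the sum over K into (r+1)|α|².
    have := hconv x (WithLp.toLp 2 fun j => a K j x)
    simpa [EuclideanSpace.norm_sq_eq] using this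
  have e6 : ∑ L : Fin r ↪o Fin n, ∑ i : Fin n, ∑ j : Fin n, T L i j x =
      ((∑ K : Fin r ↪o Fin n, codiff φ α K x ^ 2) -
      (∑ L : Fin r ↪o Fin n, ∑ i : Fin n, ∑ j : Fin n,
        pderiv j (a L i) x * pderiv i (a L j) x) -
      ∑ K : Fin r ↪o Fin n, ∑ i : Fin n, ∑ j : Fin n,
        pderiv i (pderiv j φ) x * a K i x * a K j x) * Real.exp (-φ x) := by
    simp_rw [e1, ← Finset.sum_sub_distrib, Finset.sum_mul]
    rfl
  rw [e6]
  have e7 : (∑ M : Fin (r + 2) ↪o Fin n, extDeriv α x (basisTuple M) ^ 2) =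
      (∑ K : Fin (r + 1) ↪o Fin n, ∑ j : Fin n, pderiv j (fun y => α y (basisTuple K)) x ^ 2) -
      (∑ L : Fin r ↪o Fin n, ∑ i : Fin n, ∑ j : Fin n,
        pderiv j (a L i) x * pderiv i (a L j) x) := e2
  have e8 : (∑ K : Fin r ↪o Fin n, ∑ j : Fin n, a K j x ^ 2) =
      ((r : ℝ) + 1) * ∑ M : Fin (r + 1) ↪o Fin n, α x (basisTuple M) ^ 2 := e4
  rw [e8] at e5
  simp only
  rw [e7, ← add_mul, ← mul_assoc, ← sub_mul]
  refine mul_le_mul_of_nonneg_right ?_ (Real.exp_pos _).le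
  linarith

end Forms

/-! ### Mollification and convergence in L² -/

section Mollification

open Filter Topology

variable {n : ℕ}

/-- A sequence of smooth bump functions shrinking to the origin. -/
def mollifierBump (n m : ℕ) : ContDiffBump (0 : EuclideanSpace ℝ (Fin n)) where
  rIn := 1 / (2 * ((m : ℝ) + 1))
  rOut := 1 / ((m : ℝ) + 1)
  rIn_pos := by positivity
  rIn_lt_rOut := by
    apply one_div_lt_one_div_of_lt <;> linarith [m.cast_nonneg (α := ℝ)]

/-- The standard mollifiers. -/
def mollifier (n m : ℕ) : EuclideanSpace ℝ (Fin n) → ℝ :=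
  (mollifierBump n m).normed volume

theorem mollifier_nonneg (m : ℕ) (x : EuclideanSpace ℝ (Fin n)) : 0 ≤ mollifier n m x :=
  (mollifierBump n m).nonneg_normed x

theorem contDiff_mollifier (m : ℕ) : ContDiff ℝ ∞ (mollifier n m) :=
  (mollifierBump n m).contDiff_normed

theorem hasCompactSupport_mollifier (m : ℕ) : HasCompactSupport (mollifier n m) :=
  (mollifierBump n m).hasCompactSupport_normed

theorem tendsto_rOut_mollifierBump : Tendsto (fun m => (mollifierBump n m).rOut) atTop (𝓝 0) :=
  tendsto_one_div_add_atTop_nhds_zero_nat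

theorem norm_lt_one_of_mollifier_ne_zero {m : ℕ} {x : EuclideanSpace ℝ (Fin n)}
    (h : mollifier n m x ≠ 0) : ‖x‖ < 1 := by
  have h1 : x ∈ Function.support ((mollifierBump n m).normed volume) := h
  rw [ContDiffBump.support_normed_eq, mem_ball_zero_iff] at h1
  refine h1.trans_le ?_
  change 1 / ((m : ℝ) + 1) ≤ 1
  rw [div_le_one (by positivity)]
  linarith [m.cast_nonneg (α := ℝ)]

/-- Mollification of a function. -/
def mollify (m : ℕ) (h : EuclideanSpace ℝ (Fin n) → ℝ) (x : EuclideanSpace ℝ (Fin n)) : ℝ :=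
  ∫ t, mollifier n m (x - t) * h t

theorem mollify_eq_convolution (m : ℕ) (h : EuclideanSpace ℝ (Fin n) → ℝ) :
    mollify m h =
      convolution (mollifier n m) h (ContinuousLinearMap.lsmul ℝ ℝ) volume := by
  funext x
  rw [convolution_eq_swap]
  rfl

/-- With the smooth kernel as right factor, the derivative of the convolution falls on the kernel.
-/
theorem mollify_eq_convolution_flip (m : ℕ) (h : EuclideanSpace ℝ (Fin n) → ℝ) :
    mollify m h =
      convolution h (mollifier n m) (ContinuousLinearMap.lsmul ℝ ℝ).flip volume := by
  rw [mollify_eq_convolution, convolution_flip]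

variable {h : EuclideanSpace ℝ (Fin n) → ℝ}

theorem contDiff_mollify (m : ℕ) (hh : LocallyIntegrable h) : ContDiff ℝ ∞ (mollify m h) := by
  rw [mollify_eq_convolution]
  exact (hasCompactSupport_mollifier m).contDiff_convolution_left _ (contDiff_mollifier m) hh

theorem contDiff_mollifier_sub (m : ℕ) (x : EuclideanSpace ℝ (Fin n)) :
    ContDiff ℝ ∞ fun t => mollifier n m (x - t) :=
  (contDiff_mollifier m).comp (contDiff_const.sub contDiff_id)

theorem hasCompactSupport_mollifier_sub (m : ℕ) (x : EuclideanSpace ℝ (Fin n)) :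
    HasCompactSupport fun t => mollifier n m (x - t) :=
  (hasCompactSupport_mollifier m).comp_homeomorph (Homeomorph.subLeft x)

theorem integrable_mollifier_mul (m : ℕ) (hh : LocallyIntegrable h)
    (x : EuclideanSpace ℝ (Fin n)) : Integrable fun t => mollifier n m (x - t) * h t :=
  hh.integrable_smul_left_of_hasCompactSupport (contDiff_mollifier_sub m x).continuous
    (hasCompactSupport_mollifier_sub m x)

theorem pderiv_mollifier_sub (m : ℕ) (j : Fin n) (x t : EuclideanSpace ℝ (Fin n)) :
    pderiv j (fun t => mollifier n m (x - t)) t = -pderiv j (mollifier n m) (x - t) := by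
  have h := (((contDiff_mollifier (n := n) m).differentiable (by simp)
    (x - t)).hasFDerivAt).comp t ((hasFDerivAt_id t).const_sub x)
  unfold pderiv
  rw [show (fun t => mollifier n m (x - t)) = mollifier n m ∘ HSub.hSub x from rfl, h.fderiv]
  simp

/-- Differentiating the kernel in t instead of x costs a sign; the derivative of the mollification
is then the distributional derivative tested on t ↦ ρ_m(x - t). -/
theorem pderiv_mollify (m : ℕ) (hh : LocallyIntegrable h) (j : Fin n)
    (x : EuclideanSpace ℝ (Fin n)) :
    pderiv j (mollify m h) x = -∫ t, pderiv j (fun t => mollifier n m (x - t)) t * h t := by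
  have hρ : ContDiff ℝ 1 (mollifier n m) := (contDiff_mollifier m).of_le (by simp)
  rw [pderiv, mollify_eq_convolution_flip,
    ((hasCompactSupport_mollifier m).hasFDerivAt_convolution_right _ hh hρ x).fderiv,
    convolution_precompR_apply _ hh ((hasCompactSupport_mollifier m).fderiv (𝕜 := ℝ))
      (hρ.continuous_fderiv (by simp)), convolution_def, ← integral_neg]
  refine integral_congr_ae (Eventually.of_forall fun t => ?_)
  simp only [pderiv_mollifier_sub, ContinuousLinearMap.flip_apply,
    ContinuousLinearMap.lsmul_apply, smul_eq_mul, neg_mul, neg_neg]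
  rfl

/-- Mollification commutes with first order constant coefficient operators in the weak sense. -/
theorem sum_pderiv_mollify {ι : Type*} [Fintype ι] (J : ι → Fin n)
    {F : ι → EuclideanSpace ℝ (Fin n) → ℝ} (hF : ∀ i, LocallyIntegrable (F i))
    (hweak : ∀ η : EuclideanSpace ℝ (Fin n) → ℝ, ContDiff ℝ ∞ η → HasCompactSupport η →
      ∫ x, ∑ i, pderiv (J i) η x * F i x = ∫ x, η x * h x)
    (m : ℕ) (x : EuclideanSpace ℝ (Fin n)) :
    ∑ i, pderiv (J i) (mollify m (F i)) x = -mollify m h x := by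
  have hs := contDiff_mollifier_sub m x
  have hc := hasCompactSupport_mollifier_sub m x
  simp_rw [pderiv_mollify m (hF _)]
  rw [Finset.sum_neg_distrib, ← integral_finsetSum, hweak _ hs hc]
  · rfl
  · intro i _
    exact (hF i).integrable_smul_left_of_hasCompactSupport (hs.pderiv _).continuous (hc.pderiv _)

theorem mollify_const_mul (m : ℕ) (c : ℝ) (h : EuclideanSpace ℝ (Fin n) → ℝ)
    (x : EuclideanSpace ℝ (Fin n)) : mollify m (fun t => c * h t) x = c * mollify m h x := by
  unfold mollify
  rw [← integral_const_mul]
  congr 1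
  funext t
  ring

theorem mollify_finsetSum {ι : Type*} (s : Finset ι) {F : ι → EuclideanSpace ℝ (Fin n) → ℝ}
    (hF : ∀ i ∈ s, LocallyIntegrable (F i)) (m : ℕ) (x : EuclideanSpace ℝ (Fin n)) :
    mollify m (fun t => ∑ i ∈ s, F i t) x = ∑ i ∈ s, mollify m (F i) x := by
  unfold mollify
  rw [← integral_finsetSum _ fun i hi => integrable_mollifier_mul m (hF i hi) x]
  simp_rw [Finset.mul_sum]

theorem mollify_sub (m : ℕ) {h₁ h₂ : EuclideanSpace ℝ (Fin n) → ℝ} (hh₁ : LocallyIntegrable h₁)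
    (hh₂ : LocallyIntegrable h₂) : mollify m (h₁ - h₂) = mollify m h₁ - mollify m h₂ := by
  funext x
  simp only [mollify, Pi.sub_apply]
  rw [← integral_sub (integrable_mollifier_mul m hh₁ x) (integrable_mollifier_mul m hh₂ x)]
  simp_rw [mul_sub]

-- Cauchy–Schwarz for the measure ρ dμ, obtained by splitting ρ = ρ^{1/2} ρ^{1/2}. With ρ of mass 1
-- it gives the L² contraction of mollification.
open scoped ENNReal in
theorem sq_lintegral_mul_le {X : Type*} [MeasurableSpace X] (μ : Measure X) {f ρ : X → ℝ≥0∞}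
    (hf : AEMeasurable f μ) (hρ : AEMeasurable ρ μ) :
    (∫⁻ t, ρ t * f t ∂μ) ^ 2 ≤ (∫⁻ t, ρ t ∂μ) * ∫⁻ t, ρ t * f t ^ 2 ∂μ := by
  have h := ENNReal.lintegral_mul_le_Lp_mul_Lq μ Real.HolderConjugate.two_two
    (f := fun t => ρ t ^ (1 / 2 : ℝ)) (g := fun t => ρ t ^ (1 / 2 : ℝ) * f t)
    (hρ.pow_const _) ((hρ.pow_const _).mul hf)
  have hsq : ∀ a : ℝ≥0∞, (a ^ (1 / 2 : ℝ)) ^ 2 = a := fun a => by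
    rw [← ENNReal.rpow_natCast, ← ENNReal.rpow_mul]; norm_num
  have e1 : ∀ t, ρ t ^ (1 / 2 : ℝ) * (ρ t ^ (1 / 2 : ℝ) * f t) = ρ t * f t := fun t => by
    rw [← mul_assoc, ← pow_two, hsq]
  simp only [Pi.mul_apply, e1, ENNReal.rpow_two, mul_pow, hsq] at h
  calc (∫⁻ t, ρ t * f t ∂μ) ^ 2
      ≤ ((∫⁻ t, ρ t ∂μ) ^ (1 / 2 : ℝ) * (∫⁻ t, ρ t * f t ^ 2 ∂μ) ^ (1 / 2 : ℝ)) ^ 2 := by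
        gcongr
    _ = _ := by rw [mul_pow, hsq, hsq]

theorem lintegral_mollifier (m : ℕ) :
    ∫⁻ x, ENNReal.ofReal (mollifier n m x) = 1 := by
  rw [← ofReal_integral_eq_lintegral_ofReal]
  · rw [mollifier, ContDiffBump.integral_normed, ENNReal.ofReal_one]
  · exact (contDiff_mollifier m).continuous.integrable_of_hasCompactSupport
      (hasCompactSupport_mollifier m)
  · exact Eventually.of_forall (mollifier_nonneg m)

/-- Mollification is a contraction of `L²`. -/
theorem eLpNorm_mollify_le (m : ℕ) (hh : AEStronglyMeasurable h volume) :
    eLpNorm (mollify m h) 2 volume ≤ eLpNorm h 2 volume := by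
  have key : ∫⁻ x, ‖mollify m h x‖ₑ ^ 2 ≤ ∫⁻ x, ‖h x‖ₑ ^ 2 := by
    have hm : Continuous (mollifier n m) := (contDiff_mollifier m).continuous
    calc ∫⁻ x, ‖mollify m h x‖ₑ ^ 2
        ≤ ∫⁻ x, ∫⁻ t, ENNReal.ofReal (mollifier n m (x - t)) * ‖h t‖ₑ ^ 2 := by
          refine lintegral_mono fun x => ?_
          have h1 : ‖mollify m h x‖ₑ ≤
              ∫⁻ t, ENNReal.ofReal (mollifier n m (x - t)) * ‖h t‖ₑ := by
            refine (enorm_integral_le_lintegral_enorm _).trans_eq ?_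
            refine lintegral_congr fun t => ?_
            rw [enorm_mul, Real.enorm_of_nonneg (mollifier_nonneg m _)]
          have h2 : ∫⁻ t, ENNReal.ofReal (mollifier n m (x - t)) = 1 := by
            rw [lintegral_sub_left_eq_self (fun t => ENNReal.ofReal (mollifier n m t)) x,
              lintegral_mollifier]
          calc ‖mollify m h x‖ₑ ^ 2
              ≤ (∫⁻ t, ENNReal.ofReal (mollifier n m (x - t)) * ‖h t‖ₑ) ^ 2 := by gcongr
            _ ≤ _ := sq_lintegral_mul_le _ hh.enorm (by
                have : Measurable fun t => ENNReal.ofReal (mollifier n m (x - t)) := by fun_prop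
                exact this.aemeasurable)
            _ = _ := by rw [h2, one_mul]
      _ = ∫⁻ t, ∫⁻ x, ENNReal.ofReal (mollifier n m (x - t)) * ‖h t‖ₑ ^ 2 := by
          refine lintegral_lintegral_swap ?_
          have h1 : Measurable fun z : EuclideanSpace ℝ (Fin n) × EuclideanSpace ℝ (Fin n) =>
            ENNReal.ofReal (mollifier n m (z.1 - z.2)) := by fun_prop
          exact h1.aemeasurable.mul (hh.enorm.pow_const 2).comp_snd
      _ = ∫⁻ t, ‖h t‖ₑ ^ 2 := by
          refine lintegral_congr fun t => ?_
          have hmeas : Measurable fun x => ENNReal.ofReal (mollifier n m (x - t)) := by fun_prop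
          rw [lintegral_mul_const _ hmeas,
            lintegral_sub_right_eq_self (fun x => ENNReal.ofReal (mollifier n m x)) t,
            lintegral_mollifier, one_mul]
  rw [eLpNorm_eq_lintegral_rpow_enorm_toReal (by simp) (by simp),
    eLpNorm_eq_lintegral_rpow_enorm_toReal (by simp) (by simp)]
  simp only [ENNReal.toReal_ofNat, ENNReal.rpow_two]
  gcongr

theorem mollify_eq_zero_of_notMem_cthickening {m : ℕ} {x : EuclideanSpace ℝ (Fin n)}
    {S : Set (EuclideanSpace ℝ (Fin n))} (hS : ∀ t ∉ S, h t = 0)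
    (hx : x ∉ Metric.cthickening 1 S) : mollify m h x = 0 := by
  have : ∀ t, mollifier n m (x - t) * h t = 0 := by
    intro t
    by_cases ht : mollifier n m (x - t) = 0
    · rw [ht, zero_mul]
    · by_cases htS : t ∈ S
      · exfalso
        apply hx
        refine Metric.mem_cthickening_of_dist_le x t 1 S htS ?_
        rw [dist_eq_norm]
        exact (norm_lt_one_of_mollifier_ne_zero ht).le
      · rw [hS t htS, mul_zero]
  simp [mollify, this]

/-- Uniform continuity gives uniform convergence, and all differences are supported in the closed
1-neighbourhood of the support, a fixed compact set; so the convergence holds in L². -/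
theorem tendsto_eLpNorm_mollify_sub_of_continuous (hh : Continuous h) (hc : HasCompactSupport h) :
    Tendsto (fun m => eLpNorm (mollify m h - h) 2 volume) atTop (𝓝 0) := by
  set S := Metric.cthickening 1 (tsupport h) with hS
  have hSc : IsCompact S := IsCompact.cthickening hc
  have hsupp : ∀ m, Function.support (mollify m h - h) ⊆ S := by
    intro m x hx
    by_contra hxS
    apply hx
    have h1 : mollify m h x = 0 :=
      mollify_eq_zero_of_notMem_cthickening (fun t ht => image_eq_zero_of_notMem_tsupport ht) hxS
    have h2 : h x = 0 := image_eq_zero_of_notMem_tsupport fun hx =>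
      hxS (Metric.self_subset_cthickening _ hx)
    simp [h1, h2]
  have huc : UniformContinuous h := hc.uniformContinuous_of_continuous hh
  have hbound : ∀ ε > 0, ∀ᶠ m in atTop, ∀ x, ‖(mollify m h - h) x‖ ≤ ε := by
    intro ε hε
    obtain ⟨δ, hδ, hd⟩ := Metric.uniformContinuous_iff.1 huc ε hε
    filter_upwards [(tendsto_rOut_mollifierBump (n := n)).eventually (gt_mem_nhds hδ)] with m hm x
    rw [Pi.sub_apply, ← dist_eq_norm, mollify_eq_convolution]
    refine (mollifierBump n m).dist_normed_convolution_le hh.aestronglyMeasurable fun y hy => ?_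
    exact (hd ((Metric.mem_ball.1 hy).trans hm)).le
  have hV : volume S ^ (2 : ENNReal).toReal⁻¹ ≠ ⊤ :=
    ENNReal.rpow_ne_top_of_nonneg (by positivity) hSc.measure_lt_top.ne
  rw [ENNReal.tendsto_nhds_zero]
  intro ε hε
  obtain ⟨ε', hε', hlt⟩ : ∃ ε' : ℝ, 0 < ε' ∧
      volume S ^ (2 : ENNReal).toReal⁻¹ * ENNReal.ofReal ε' ≤ ε := by
    have ht : Tendsto (fun a : ℝ => volume S ^ (2 : ENNReal).toReal⁻¹ * ENNReal.ofReal a)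
        (𝓝[>] 0) (𝓝 (volume S ^ (2 : ENNReal).toReal⁻¹ * ENNReal.ofReal 0)) :=
      ENNReal.Tendsto.const_mul
        ((ENNReal.continuous_ofReal.tendsto 0).mono_left nhdsWithin_le_nhds) (Or.inr hV)
    rw [ENNReal.ofReal_zero, mul_zero] at ht
    obtain ⟨a, ha, ha'⟩ := ((ENNReal.tendsto_nhds_zero.1 ht ε hε).and
      self_mem_nhdsWithin).exists
    exact ⟨a, ha', ha⟩
  filter_upwards [hbound ε' hε'] with m hm
  rw [← eLpNorm_restrict_eq_of_support_subset (hsupp m)]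
  refine (eLpNorm_le_of_ae_bound (Eventually.of_forall hm)).trans ?_
  rwa [Measure.restrict_apply_univ]

/-- Approximate h by a continuous compactly supported v; the error h - v is not enlarged by
mollification, so three terms of size ε/3 suffice. -/
theorem tendsto_eLpNorm_mollify_sub (hh : MemLp h 2 volume) :
    Tendsto (fun m => eLpNorm (mollify m h - h) 2 volume) atTop (𝓝 0) := by
  rw [ENNReal.tendsto_nhds_zero]
  intro ε hε
  have hε3 : ε / 3 ≠ 0 := (ENNReal.div_pos hε.ne' (by simp)).ne'
  obtain ⟨v, hvc, hv, hvcont, hvL⟩ := hh.exists_hasCompactSupport_eLpNorm_sub_le (by simp) hε3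
  have hl : LocallyIntegrable h := hh.locallyIntegrable one_le_two
  have hvl : LocallyIntegrable v := hvL.locallyIntegrable one_le_two
  filter_upwards [ENNReal.tendsto_nhds_zero.1
    (tendsto_eLpNorm_mollify_sub_of_continuous hvcont hvc) (ε / 3)
    (pos_iff_ne_zero.2 hε3)] with m hm
  have e : mollify m h - h = mollify m (h - v) + (mollify m v - v) + (v - h) := by
    rw [mollify_sub m hl hvl]; abel
  have m1 : AEStronglyMeasurable (mollify m (h - v)) volume :=
    (contDiff_mollify m (hl.sub hvl)).continuous.aestronglyMeasurable
  have m2 : AEStronglyMeasurable (mollify m v - v) volume :=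
    ((contDiff_mollify m hvl).continuous.sub hvcont).aestronglyMeasurable
  have m3 : AEStronglyMeasurable (v - h) volume := (hvL.sub hh).aestronglyMeasurable
  calc eLpNorm (mollify m h - h) 2 volume
      ≤ eLpNorm (mollify m (h - v)) 2 volume + eLpNorm (mollify m v - v) 2 volume +
        eLpNorm (v - h) 2 volume := by
        rw [e]
        refine (eLpNorm_add_le (m1.add m2) m3 one_le_two).trans ?_
        gcongr
        exact eLpNorm_add_le m1 m2 one_le_two
    _ ≤ ε / 3 + ε / 3 + ε / 3 := by
        gcongr
        · exact (eLpNorm_mollify_le m (hh.sub hvL).aestronglyMeasurable).trans hv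
        · rw [eLpNorm_sub_comm]; exact hv
    _ = ε := ENNReal.add_thirds ε

/-- Local square integrability. -/
def LocL2 (h : EuclideanSpace ℝ (Fin n) → ℝ) : Prop :=
  ∀ K : Set (EuclideanSpace ℝ (Fin n)), IsCompact K → MemLp h 2 (volume.restrict K)

theorem LocL2.locallyIntegrable (hh : LocL2 h) : LocallyIntegrable h := by
  rw [locallyIntegrable_iff]
  intro K hK
  have : IsFiniteMeasure (volume.restrict K) := ⟨by
    rw [Measure.restrict_apply_univ]; exact hK.measure_lt_top⟩
  exact (hh K hK).integrable one_le_two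

theorem MemLp.locL2 (hh : MemLp h 2 volume) : LocL2 h := fun _ _ => hh.restrict _

theorem LocL2.continuous_mul (hh : LocL2 h) {b : EuclideanSpace ℝ (Fin n) → ℝ}
    (hb : Continuous b) : LocL2 fun x => b x * h x := by
  intro K hK
  obtain ⟨C, hC⟩ := hK.exists_bound_of_continuousOn hb.continuousOn
  refine (hh K hK).of_le_mul (c := C)
    (hb.aestronglyMeasurable.mul (hh K hK).aestronglyMeasurable) ?_
  filter_upwards [ae_restrict_mem hK.measurableSet] with x hx
  rw [norm_mul]
  exact mul_le_mul_of_nonneg_right (hC x hx) (norm_nonneg _)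

theorem LocL2.sum {ι : Type*} (s : Finset ι) {F : ι → EuclideanSpace ℝ (Fin n) → ℝ}
    (hF : ∀ i ∈ s, LocL2 (F i)) : LocL2 fun x => ∑ i ∈ s, F i x :=
  fun K hK => memLp_finsetSum s fun i hi => hF i hi K hK

theorem LocL2.sub {h₁ h₂ : EuclideanSpace ℝ (Fin n) → ℝ} (hh₁ : LocL2 h₁) (hh₂ : LocL2 h₂) :
    LocL2 fun x => h₁ x - h₂ x :=
  fun K hK => (hh₁ K hK).sub (hh₂ K hK)

theorem Continuous.locL2 (hh : Continuous h) : LocL2 h := by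
  intro K hK
  have : IsFiniteMeasure (volume.restrict K) := ⟨by
    rw [Measure.restrict_apply_univ]; exact hK.measure_lt_top⟩
  obtain ⟨C, hC⟩ := hK.exists_bound_of_continuousOn hh.continuousOn
  refine MemLp.of_bound hh.aestronglyMeasurable C ?_
  filter_upwards [ae_restrict_mem hK.measurableSet] with x hx
  exact hC x hx

theorem LocL2.memLp_mul (hh : LocL2 h) {b : EuclideanSpace ℝ (Fin n) → ℝ}
    (hb : Continuous b) (hc : HasCompactSupport b) : MemLp (fun x => b x * h x) 2 volume := by
  have hs : Function.support (fun x => b x * h x) ⊆ tsupport b := fun x hx =>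
    subset_tsupport b (left_ne_zero_of_mul hx)
  have h1 := (hh.continuous_mul hb) _ hc
  have e : (tsupport b).indicator (fun x => b x * h x) = fun x => b x * h x :=
    Set.indicator_eq_self.2 hs
  rw [← e, memLp_indicator_iff_restrict (isClosed_tsupport b).measurableSet]
  exact h1

/-- The kernels live in the unit ball, so on K the mollification sees only the values of h on the
1-neighbourhood of K, and h may be truncated to a global L² function. -/
theorem tendsto_eLpNorm_restrict_mollify_sub (hh : LocL2 h)
    {K : Set (EuclideanSpace ℝ (Fin n))} (hK : IsCompact K) :
    Tendsto (fun m => eLpNorm (mollify m h - h) 2 (volume.restrict K)) atTop (𝓝 0) := by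
  set S := Metric.cthickening 1 K with hS
  have hSc : IsCompact S := IsCompact.cthickening hK
  have hL : MemLp (S.indicator h) 2 volume :=
    (memLp_indicator_iff_restrict hSc.measurableSet).2 (hh S hSc)
  refine tendsto_of_tendsto_of_tendsto_of_le_of_le tendsto_const_nhds
    (tendsto_eLpNorm_mollify_sub hL) (fun m => zero_le) fun m => ?_
  refine le_trans (le_of_eq ?_) (eLpNorm_mono_measure _ Measure.restrict_le_self (μ := volume)
    (ν := volume.restrict K))
  refine eLpNorm_congr_ae ?_
  filter_upwards [ae_restrict_mem hK.measurableSet] with x hx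
  have h1 : mollify m h x = mollify m (S.indicator h) x := by
    unfold mollify
    congr 1
    funext t
    by_cases ht : mollifier n m (x - t) = 0
    · rw [ht, zero_mul, zero_mul]
    · rw [Set.indicator_of_mem]
      refine Metric.mem_cthickening_of_dist_le t x 1 K hx ?_
      rw [dist_comm, dist_eq_norm]
      exact (norm_lt_one_of_mollifier_ne_zero ht).le
  rw [Pi.sub_apply, Pi.sub_apply, h1, Set.indicator_of_mem (Metric.self_subset_cthickening _ hx)]

/-- Convergence in `L²` of a sequence of square integrable functions. -/
structure L2Tendsto (F : ℕ → EuclideanSpace ℝ (Fin n) → ℝ) (G : EuclideanSpace ℝ (Fin n) → ℝ) :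
    Prop where
  memLp : ∀ m, MemLp (F m) 2 volume
  memLp_lim : MemLp G 2 volume
  tendsto : Tendsto (fun m => eLpNorm (F m - G) 2 volume) atTop (𝓝 0)

theorem L2Tendsto.sub {F F' : ℕ → EuclideanSpace ℝ (Fin n) → ℝ}
    {G G' : EuclideanSpace ℝ (Fin n) → ℝ} (h₁ : L2Tendsto F G) (h₂ : L2Tendsto F' G') :
    L2Tendsto (fun m x => F m x - F' m x) (fun x => G x - G' x) where
  memLp m := (h₁.memLp m).sub (h₂.memLp m)
  memLp_lim := h₁.memLp_lim.sub h₂.memLp_lim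
  tendsto := by
    have h := h₁.tendsto.add h₂.tendsto
    rw [add_zero] at h
    refine tendsto_of_tendsto_of_tendsto_of_le_of_le tendsto_const_nhds h
      (fun m => zero_le) fun m => ?_
    have e : (fun x => F m x - F' m x) - (fun x => G x - G' x) = (F m - G) - (F' m - G') := by
      funext x; simp only [Pi.sub_apply]; ring
    rw [e]
    exact eLpNorm_sub_le ((h₁.memLp m).sub h₁.memLp_lim).aestronglyMeasurable
      ((h₂.memLp m).sub h₂.memLp_lim).aestronglyMeasurable one_le_two

theorem L2Tendsto.sum {ι : Type*} (s : Finset ι) {F : ι → ℕ → EuclideanSpace ℝ (Fin n) → ℝ}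
    {G : ι → EuclideanSpace ℝ (Fin n) → ℝ} (h : ∀ i ∈ s, L2Tendsto (F i) (G i)) :
    L2Tendsto (fun m x => ∑ i ∈ s, F i m x) (fun x => ∑ i ∈ s, G i x) where
  memLp m := memLp_finsetSum s fun i hi => (h i hi).memLp m
  memLp_lim := memLp_finsetSum s fun i hi => (h i hi).memLp_lim
  tendsto := by
    have ht := tendsto_finsetSum s fun i hi => (h i hi).tendsto
    rw [Finset.sum_const_zero] at ht
    refine tendsto_of_tendsto_of_tendsto_of_le_of_le tendsto_const_nhds ht
      (fun m => zero_le) fun m => ?_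
    have e : (fun x => ∑ i ∈ s, F i m x) - (fun x => ∑ i ∈ s, G i x) =
        ∑ i ∈ s, (F i m - G i) := by
      funext x; simp [Finset.sum_apply]
    rw [e]
    exact eLpNorm_sum_le (fun i hi =>
      (((h i hi).memLp m).sub (h i hi).memLp_lim).aestronglyMeasurable) one_le_two

/-- A compactly supported continuous multiplier turns local L² convergence into global convergence.
Every term of the localized approximations has this shape. -/
theorem L2Tendsto.mul_mollify (hh : LocL2 h) {b : EuclideanSpace ℝ (Fin n) → ℝ}
    (hb : Continuous b) (hc : HasCompactSupport b) :
    L2Tendsto (fun m x => b x * mollify m h x) (fun x => b x * h x) where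
  memLp m := (contDiff_mollify m hh.locallyIntegrable).continuous.locL2.memLp_mul hb hc
  memLp_lim := hh.memLp_mul hb hc
  tendsto := by
    obtain ⟨C, hC⟩ := hc.exists_bound_of_continuous hb
    have ht := ENNReal.Tendsto.const_mul (a := ENNReal.ofReal C)
      (tendsto_eLpNorm_restrict_mollify_sub hh hc) (Or.inr ENNReal.ofReal_ne_top)
    rw [mul_zero] at ht
    refine tendsto_of_tendsto_of_tendsto_of_le_of_le tendsto_const_nhds ht
      (fun m => zero_le) fun m => ?_
    have e : (fun x => b x * mollify m h x) - (fun x => b x * h x) =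
        fun x => b x * (mollify m h - h) x := by
      funext x; simp only [Pi.sub_apply]; ring
    have hs : Function.support (fun x => b x * (mollify m h - h) x) ⊆ tsupport b := fun x hx =>
      subset_tsupport b (left_ne_zero_of_mul hx)
    rw [e, ← eLpNorm_restrict_eq_of_support_subset hs]
    refine eLpNorm_le_mul_eLpNorm_of_ae_le_mul (Eventually.of_forall fun x => ?_) 2
    rw [norm_mul]
    exact mul_le_mul_of_nonneg_right (hC x) (norm_nonneg _)

theorem L2Tendsto.tendsto_integral_sq {F : ℕ → EuclideanSpace ℝ (Fin n) → ℝ}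
    {G : EuclideanSpace ℝ (Fin n) → ℝ} (hFG : L2Tendsto F G) :
    Tendsto (fun m => ∫ x, F m x ^ 2) atTop (𝓝 (∫ x, G x ^ 2)) := by
  have h1 := (Lp.tendsto_Lp_iff_tendsto_eLpNorm'' F hFG.memLp G hFG.memLp_lim).2 hFG.tendsto
  have key : ∀ (H : EuclideanSpace ℝ (Fin n) → ℝ) (hH : MemLp H 2 volume),
      ‖hH.toLp H‖ ^ 2 = ∫ x, H x ^ 2 := by
    intro H hH
    rw [← real_inner_self_eq_norm_sq, L2.inner_def]
    refine integral_congr_ae ?_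
    filter_upwards [hH.coeFn_toLp] with x hx
    rw [hx]
    simp
  have h2 := (h1.norm).pow 2
  simpa only [key] using h2

end Mollification

/-! ### The a priori estimate for square integrable forms -/

section WeakEstimate

open Filter Topology

variable {n : ℕ} {φ : EuclideanSpace ℝ (Fin n) → ℝ}

theorem exp_neg_half_sq (t : ℝ) : Real.exp (-t / 2) ^ 2 = Real.exp (-t) := by
  rw [← Real.exp_nat_mul]
  congr 1
  push_cast
  ring

theorem integral_sum_sq_mul_exp {ι : Type*} [Fintype ι]
    {F : ι → EuclideanSpace ℝ (Fin n) → ℝ}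
    (hF : ∀ i, MemLp (fun x => Real.exp (-φ x / 2) * F i x) 2 volume) :
    ∫ x, (∑ i, F i x ^ 2) * Real.exp (-φ x) =
      ∑ i, ∫ x, (Real.exp (-φ x / 2) * F i x) ^ 2 := by
  rw [← integral_finsetSum _ fun i _ => (hF i).integrable_sq]
  congr 1
  funext x
  simp_rw [mul_pow, exp_neg_half_sq, Finset.sum_mul]
  exact Finset.sum_congr rfl fun i _ => mul_comm _ _

/-- The value on fixed vectors is a combination of the coefficients with constant factors, so
integrability and mollification pass from coefficients to all such values. -/
theorem alternating_apply_eq_sum {q : ℕ} (g : DForm n q)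
    (v : Fin q → EuclideanSpace ℝ (Fin n)) (x : EuclideanSpace ℝ (Fin n)) :
    g x v = ∑ I : Fin q ↪o Fin n, elemForm I v * g.coeff I x := by
  conv_lhs => rw [alternating_eq_sum (g x)]
  rw [ContinuousAlternatingMap.sum_apply]
  exact Finset.sum_congr rfl fun I _ => mul_comm _ _

theorem DForm.locL2_apply {q : ℕ} {g : DForm n q} (hg : ∀ I, LocL2 (g.coeff I))
    (v : Fin q → EuclideanSpace ℝ (Fin n)) : LocL2 fun x => g x v := by
  simp_rw [alternating_apply_eq_sum g v]
  exact LocL2.sum _ fun I _ => (hg I).continuous_mul continuous_const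

theorem DForm.memLp_apply {q : ℕ} {g : DForm n q} {b : EuclideanSpace ℝ (Fin n) → ℝ}
    (hg : ∀ I, MemLp (fun x => b x * g.coeff I x) 2 volume)
    (v : Fin q → EuclideanSpace ℝ (Fin n)) : MemLp (fun x => b x * g x v) 2 volume := by
  have e : (fun x => b x * g x v) =
      fun x => ∑ I : Fin q ↪o Fin n, elemForm I v * (b x * g.coeff I x) := by
    funext x
    rw [alternating_apply_eq_sum g v, Finset.mul_sum]
    exact Finset.sum_congr rfl fun I _ => by ring
  rw [e]
  exact memLp_finsetSum _ fun I _ => (hg I).const_mul _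

/-- Mollification of the coefficients of a form. -/
def mollifyForm {q : ℕ} (m : ℕ) (g : DForm n q) : DForm n q := fun x =>
  ∑ I : Fin q ↪o Fin n, mollify m (g.coeff I) x • elemForm I

theorem mollifyForm_apply {q : ℕ} {g : DForm n q} (hg : ∀ I, LocL2 (g.coeff I)) (m : ℕ)
    (v : Fin q → EuclideanSpace ℝ (Fin n)) (x : EuclideanSpace ℝ (Fin n)) :
    mollifyForm m g x v = mollify m (fun y => g y v) x := by
  simp_rw [alternating_apply_eq_sum g v]
  rw [mollify_finsetSum _ fun I _ =>
    ((hg I).continuous_mul (b := fun _ => elemForm I v) continuous_const).locallyIntegrable]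
  simp_rw [mollify_const_mul]
  rw [mollifyForm, ContinuousAlternatingMap.sum_apply]
  exact Finset.sum_congr rfl fun I _ => mul_comm _ _

theorem contDiff_mollifyForm {q : ℕ} {g : DForm n q} (hg : ∀ I, LocL2 (g.coeff I)) (m : ℕ) :
    ContDiff ℝ ∞ (mollifyForm m g) :=
  ContDiff.sum fun I _ => (contDiff_mollify m (hg I).locallyIntegrable).smul contDiff_const

/-- `g` is closed and has weighted codifferential `s`, tested coefficient by coefficient. -/
structure IsWeakPair {r : ℕ} (φ : EuclideanSpace ℝ (Fin n) → ℝ) (g : DForm n (r + 1))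
    (s : DForm n r) : Prop where
  locL2_left : ∀ I, LocL2 (g.coeff I)
  locL2_right : ∀ I, LocL2 (s.coeff I)
  closed : ∀ (M : Fin (r + 2) ↪o Fin n) (η : EuclideanSpace ℝ (Fin n) → ℝ), ContDiff ℝ ∞ η →
    HasCompactSupport η →
    ∫ x, ∑ k : Fin (r + 2), pderiv (M k) η x * ((-1) ^ (k : ℕ) * g.coeff (removeIndex M k) x) = 0
  coclosed : ∀ (K : Fin r ↪o Fin n) (η : EuclideanSpace ℝ (Fin n) → ℝ), ContDiff ℝ ∞ η →
    HasCompactSupport η →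
    ∫ x, ∑ j : Fin n, pderiv j η x * g x (basisTuple (Fin.cons j K : Fin (r + 1) → Fin n)) =
      ∫ x, η x * (s.coeff K x - ∑ j : Fin n,
        pderiv j φ x * g x (basisTuple (Fin.cons j K : Fin (r + 1) → Fin n)))

variable {r : ℕ} {g : DForm n (r + 1)} {s : DForm n r}

theorem IsWeakPair.locL2_codiff (hφ : ContDiff ℝ ∞ φ) (h : IsWeakPair φ g s)
    (K : Fin r ↪o Fin n) : LocL2 fun x => s.coeff K x - ∑ j : Fin n,
      pderiv j φ x * g x (basisTuple (Fin.cons j K : Fin (r + 1) → Fin n)) :=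
  (h.locL2_right K).sub (LocL2.sum _ fun j _ =>
    (DForm.locL2_apply h.locL2_left _).continuous_mul (hφ.pderiv j).continuous)

/-- The weak equation says that s - ∑ ∂_jφ g_j is minus a constant-coefficient divergence of g, and
mollification commutes with that divergence. The variable coefficient ∂φ thus occurs only in
zero-order terms, once inside and once outside the mollification, and no commutator estimate is
needed. -/
theorem IsWeakPair.codiff_cutoff_mollify (hφ : ContDiff ℝ ∞ φ) (h : IsWeakPair φ g s)
    {χ : EuclideanSpace ℝ (Fin n) → ℝ} (hχ : ContDiff ℝ ∞ χ) (m : ℕ) (K : Fin r ↪o Fin n)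
    (x : EuclideanSpace ℝ (Fin n)) :
    codiff φ (fun x => χ x • mollifyForm m g x) K x =
      χ x * mollify m (fun x => s.coeff K x - ∑ j : Fin n,
        pderiv j φ x * g x (basisTuple (Fin.cons j K : Fin (r + 1) → Fin n))) x -
      ∑ j : Fin n, (pderiv j χ x - χ x * pderiv j φ x) *
        mollify m (fun x => g x (basisTuple (Fin.cons j K : Fin (r + 1) → Fin n))) x := by
  have hl : ∀ v, LocL2 fun x => g x v := DForm.locL2_apply h.locL2_left
  have hsm := contDiff_mollifyForm h.locL2_left m
  rw [codiff_eq (β := fun x => χ x • mollifyForm m g x) hφ (hχ.smul hsm)]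
  simp only [ContinuousAlternatingMap.smul_apply, smul_eq_mul, mollifyForm_apply h.locL2_left]
  have h1 := sum_pderiv_mollify (fun j : Fin n => j)
    (F := fun j x => g x (basisTuple (Fin.cons j K : Fin (r + 1) → Fin n)))
    (fun j => (hl _).locallyIntegrable) (h.coclosed K) m x
  have h2 : ∀ j : Fin n, pderiv j (fun y => χ y *
      mollify m (fun x => g x (basisTuple (Fin.cons j K : Fin (r + 1) → Fin n))) y) x =
      pderiv j χ x * mollify m (fun x => g x (basisTuple (Fin.cons j K : Fin (r + 1) → Fin n))) x +
      χ x * pderiv j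
        (mollify m (fun x => g x (basisTuple (Fin.cons j K : Fin (r + 1) → Fin n)))) x :=
    fun j => pderiv_mul hχ (contDiff_mollify m (hl _).locallyIntegrable) j x
  simp_rw [h2]
  rw [← neg_neg (mollify m _ x), ← h1, mul_neg, Finset.mul_sum, ← Finset.sum_neg_distrib,
    ← Finset.sum_neg_distrib, ← Finset.sum_sub_distrib]
  refine Finset.sum_congr rfl fun j _ => ?_
  ring

/-- The mollified form is exactly closed, so only the term dχ ∧ g_m of the product rule survives. -/
theorem IsWeakPair.extDeriv_cutoff_mollify (h : IsWeakPair φ g s)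
    {χ : EuclideanSpace ℝ (Fin n) → ℝ} (hχ : ContDiff ℝ ∞ χ) (m : ℕ) (M : Fin (r + 2) ↪o Fin n)
    (x : EuclideanSpace ℝ (Fin n)) :
    extDeriv (fun x => χ x • mollifyForm m g x) x (basisTuple M) =
      ∑ k : Fin (r + 2), ((-1) ^ (k : ℕ) * pderiv (M k) χ x) *
        mollify m (g.coeff (removeIndex M k)) x := by
  have hsm := contDiff_mollifyForm h.locL2_left m
  have hL := fun k : Fin (r + 2) => (h.locL2_left (removeIndex M k)).continuous_mul
    (b := fun _ => (-1) ^ (k : ℕ)) continuous_const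
  rw [extDeriv_basisTuple (α := fun x => χ x • mollifyForm m g x) (hχ.smul hsm)]
  simp only [ContinuousAlternatingMap.smul_apply, smul_eq_mul, mollifyForm_apply h.locL2_left]
  have h1 := sum_pderiv_mollify (h := fun _ => 0) (fun k : Fin (r + 2) => M k)
    (F := fun k x => (-1) ^ (k : ℕ) * g.coeff (removeIndex M k) x)
    (fun k => (hL k).locallyIntegrable)
    (fun η hη hc => by rw [h.closed M η hη hc]; simp) m x
  have h0 : mollify m (fun _ => 0) x = 0 := by simp [mollify]
  rw [h0, neg_zero] at h1
  have h2 : ∀ k : Fin (r + 2), (-1) ^ (k : ℕ) * pderiv (M k) (fun y => χ y *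
      mollify m (fun x => g x (basisTuple (removeIndex M k))) y) x =
      ((-1) ^ (k : ℕ) * pderiv (M k) χ x) * mollify m (g.coeff (removeIndex M k)) x +
      χ x * pderiv (M k) (mollify m fun x => (-1) ^ (k : ℕ) * g.coeff (removeIndex M k) x) x := by
    intro k
    have hs := contDiff_mollify m (h.locL2_left (removeIndex M k)).locallyIntegrable
    have e : (mollify m fun x => (-1) ^ (k : ℕ) * g.coeff (removeIndex M k) x) =
        fun x => (-1) ^ (k : ℕ) * mollify m (g.coeff (removeIndex M k)) x :=
      funext fun x => mollify_const_mul m _ _ x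
    rw [e, pderiv_const_mul hs]
    have := pderiv_mul hχ hs (M k) x
    change (-1) ^ (k : ℕ) * pderiv (M k)
      (fun y => χ y * mollify m (g.coeff (removeIndex M k)) y) x = _
    rw [this]
    ring
  rw [Finset.sum_congr rfl fun k _ => h2 k, Finset.sum_add_distrib, ← Finset.mul_sum, h1, mul_zero,
    add_zero]

/-- The a priori estimate for a weak pair localized by a cutoff function. -/
theorem IsWeakPair.cutoff_estimate (hφ : ContDiff ℝ ∞ φ) {c : ℝ}
    (hconv : ∀ x w : EuclideanSpace ℝ (Fin n),
      c * ‖w‖ ^ 2 ≤ ∑ j : Fin n, ∑ k : Fin n, pderiv j (pderiv k φ) x * w j * w k)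
    (h : IsWeakPair φ g s) {χ : EuclideanSpace ℝ (Fin n) → ℝ} (hχ : ContDiff ℝ ∞ χ)
    (hχc : HasCompactSupport χ) :
    c * ((r : ℝ) + 1) * ∑ M : Fin (r + 1) ↪o Fin n,
        ∫ x, (χ x * (Real.exp (-φ x / 2) * g.coeff M x)) ^ 2 ≤
      (∑ K : Fin r ↪o Fin n, ∫ x, (χ x * (Real.exp (-φ x / 2) * s.coeff K x) - ∑ j : Fin n,
        pderiv j χ x * (Real.exp (-φ x / 2) *
          g x (basisTuple (Fin.cons j K : Fin (r + 1) → Fin n)))) ^ 2) +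
      ∑ M : Fin (r + 2) ↪o Fin n, ∫ x, (∑ k : Fin (r + 2), ((-1) ^ (k : ℕ) * pderiv (M k) χ x) *
        (Real.exp (-φ x / 2) * g.coeff (removeIndex M k) x)) ^ 2 := by
  have hE : Continuous fun x => Real.exp (-φ x / 2) := by
    have := hφ.continuous
    fun_prop
  have hl : ∀ v, LocL2 fun x => g x v := DForm.locL2_apply h.locL2_left
  have hχ' : ∀ j, Continuous (pderiv j χ) := fun j => (hχ.pderiv j).continuous
  have hφ' : ∀ j, Continuous (pderiv j φ) := fun j => (hφ.pderiv j).continuous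
  let α : ℕ → DForm n (r + 1) := fun m x => χ x • mollifyForm m g x
  have hα : ∀ m, (α m).IsTest := fun m =>
    ⟨hχ.smul (contDiff_mollifyForm h.locL2_left m), hχc.smul_right⟩
  -- The factor e^{-φ/2} is put into the functions, so that weighted norms become norms in
  -- unweighted L².
  have t1 : ∀ M : Fin (r + 1) ↪o Fin n, L2Tendsto
      (fun m x => Real.exp (-φ x / 2) * α m x (basisTuple M))
      (fun x => χ x * (Real.exp (-φ x / 2) * g.coeff M x)) := by
    intro M
    have := L2Tendsto.mul_mollify (h.locL2_left M) (hχ.continuous.mul hE) hχc.mul_right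
    convert this using 1
    · funext m x
      simp only [α, ContinuousAlternatingMap.smul_apply, smul_eq_mul,
        mollifyForm_apply h.locL2_left, Pi.mul_apply]
      change _ * (_ * mollify m (g.coeff M) x) = _
      ring
    · funext x
      simp only [Pi.mul_apply]
      ring
  -- In the limit the two ∂φ terms, inside and outside the mollification, cancel; what remains is χs
  -- minus the contraction of g with ∂χ.
  have t2 : ∀ K : Fin r ↪o Fin n, L2Tendsto
      (fun m x => Real.exp (-φ x / 2) * codiff φ (α m) K x)
      (fun x => χ x * (Real.exp (-φ x / 2) * s.coeff K x) - ∑ j : Fin n,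
        pderiv j χ x * (Real.exp (-φ x / 2) *
          g x (basisTuple (Fin.cons j K : Fin (r + 1) → Fin n)))) := by
    intro K
    have a1 := L2Tendsto.mul_mollify (h.locL2_codiff hφ K) (hχ.continuous.mul hE) hχc.mul_right
    have a2 := L2Tendsto.sum Finset.univ fun (j : Fin n) _ =>
      L2Tendsto.mul_mollify (hl (basisTuple (Fin.cons j K : Fin (r + 1) → Fin n)))
        (((hχ' j).sub (hχ.continuous.mul (hφ' j))).mul hE)
        (((hχc.pderiv j).sub hχc.mul_right).mul_right)
    convert a1.sub a2 using 1
    · funext m x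
      simp only [α]
      rw [h.codiff_cutoff_mollify hφ hχ, mul_sub, Finset.mul_sum]
      simp only [Pi.mul_apply, Pi.sub_apply]
      congr 1
      · ring
      · exact Finset.sum_congr rfl fun j _ => by ring
    · funext x
      simp only [Pi.mul_apply, Pi.sub_apply]
      rw [mul_sub, Finset.mul_sum, sub_sub, ← Finset.sum_add_distrib]
      congr 1
      · ring
      · exact Finset.sum_congr rfl fun j _ => by ring
  have t3 : ∀ M : Fin (r + 2) ↪o Fin n, L2Tendsto
      (fun m x => Real.exp (-φ x / 2) * extDeriv (α m) x (basisTuple M))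
      (fun x => ∑ k : Fin (r + 2), ((-1) ^ (k : ℕ) * pderiv (M k) χ x) *
        (Real.exp (-φ x / 2) * g.coeff (removeIndex M k) x)) := by
    intro M
    have a2 := L2Tendsto.sum Finset.univ fun (k : Fin (r + 2)) _ =>
      L2Tendsto.mul_mollify (h.locL2_left (removeIndex M k))
        ((continuous_const (y := (-1 : ℝ) ^ (k : ℕ))).mul ((hχ' (M k)).mul hE))
        (HasCompactSupport.mul_left (hχc.pderiv (M k)).mul_right)
    convert a2 using 1
    · funext m x
      simp only [α]
      rw [h.extDeriv_cutoff_mollify hχ, Finset.mul_sum]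
      simp only [Pi.mul_apply]
      exact Finset.sum_congr rfl fun j _ => by ring
    · funext x
      simp only [Pi.mul_apply]
      exact Finset.sum_congr rfl fun j _ => by ring
  refine le_of_tendsto_of_tendsto'
    ((tendsto_finsetSum _ fun M _ => (t1 M).tendsto_integral_sq).const_mul _)
    ((tendsto_finsetSum _ fun K _ => (t2 K).tendsto_integral_sq).add
      (tendsto_finsetSum _ fun M _ => (t3 M).tendsto_integral_sq)) fun m => ?_
  have := bochner_inequality hφ hconv (hα m)
  rwa [integral_sum_sq_mul_exp fun M => (t1 M).memLp m,
    integral_sum_sq_mul_exp fun M => (t2 M).memLp m,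
    integral_sum_sq_mul_exp fun M => (t3 M).memLp m] at this

/-- Dominated convergence in `L²` for bounded multipliers. -/
theorem L2Tendsto.of_bounded_mul {b : ℕ → EuclideanSpace ℝ (Fin n) → ℝ} {b₀ C : ℝ}
    (hb : ∀ m, Continuous (b m)) (hC : ∀ m x, ‖b m x‖ ≤ C)
    (ht : ∀ x, Tendsto (fun m => b m x) atTop (𝓝 b₀)) {h : EuclideanSpace ℝ (Fin n) → ℝ}
    (hh : MemLp h 2 volume) : L2Tendsto (fun m x => b m x * h x) (fun x => b₀ * h x) where
  memLp m := by
    refine hh.of_le_mul (c := C) ((hb m).aestronglyMeasurable.mul hh.aestronglyMeasurable)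
      (Eventually.of_forall fun x => ?_)
    rw [norm_mul]
    exact mul_le_mul_of_nonneg_right (hC m x) (norm_nonneg _)
  memLp_lim := hh.const_mul _
  tendsto := by
    have hb₀ : ∀ x : EuclideanSpace ℝ (Fin n), ‖b₀‖ ≤ C := fun x =>
      le_of_tendsto' (ht x).norm fun m => hC m x
    have key : Tendsto (fun m => ∫⁻ x, ‖(b m x - b₀) * h x‖ₑ ^ 2) atTop (𝓝 0) := by
      have hd := tendsto_lintegral_of_dominated_convergence' (μ := volume)
        (F := fun m x => ‖(b m x - b₀) * h x‖ₑ ^ 2) (f := fun _ => 0)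
        (fun x => ‖(2 * C) * h x‖ₑ ^ 2)
        (fun m => ((((hb m).sub continuous_const).aestronglyMeasurable.mul
          hh.aestronglyMeasurable).enorm.pow_const 2))
        (fun m => Eventually.of_forall fun x => by
          simp only
          gcongr ?_ ^ 2
          rw [← ofReal_norm, ← ofReal_norm]
          refine ENNReal.ofReal_le_ofReal ?_
          rw [norm_mul, norm_mul]
          refine mul_le_mul_of_nonneg_right ?_ (norm_nonneg _)
          calc ‖b m x - b₀‖ ≤ ‖b m x‖ + ‖b₀‖ := norm_sub_le _ _
            _ ≤ C + C := add_le_add (hC m x) (hb₀ x)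
            _ = 2 * C := by ring
            _ ≤ ‖2 * C‖ := Real.le_norm_self _)
        (by
          have := (hh.const_mul (2 * C)).eLpNorm_lt_top
          have h2 := lintegral_rpow_enorm_lt_top_of_eLpNorm_lt_top (by simp) (by simp) this
          simpa only [ENNReal.toReal_ofNat, ENNReal.rpow_two] using h2.ne)
        (Eventually.of_forall fun x => by
          have h1 : Tendsto (fun m => (b m x - b₀) * h x) atTop (𝓝 0) := by
            simpa using ((ht x).sub_const b₀).mul_const (h x)
          have h2 := ENNReal.Tendsto.pow (n := 2) h1.enorm
          simpa using h2)
      simpa using hd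
    have hr := key.ennrpow_const (1 / 2 : ℝ)
    rw [ENNReal.zero_rpow_of_pos (by norm_num)] at hr
    refine hr.congr fun m => ?_
    rw [eLpNorm_eq_lintegral_rpow_enorm_toReal (by simp) (by simp)]
    simp only [ENNReal.toReal_ofNat, ENNReal.rpow_two, Pi.sub_apply, ← sub_mul]

/-- A smooth cutoff function equal to `1` on the ball of radius `R + 1`. -/
def cutoff (n R : ℕ) (x : EuclideanSpace ℝ (Fin n)) : ℝ :=
  (⟨1, 2, one_pos, one_lt_two⟩ : ContDiffBump (0 : EuclideanSpace ℝ (Fin n)))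
    ((1 / ((R : ℝ) + 1)) • x)

theorem contDiff_cutoff (R : ℕ) : ContDiff ℝ ∞ (cutoff n R) :=
  (ContDiffBump.contDiff _).comp (contDiff_const_smul _)

theorem hasCompactSupport_cutoff (R : ℕ) : HasCompactSupport (cutoff n R) :=
  (ContDiffBump.hasCompactSupport _).comp_smul (by positivity)

theorem norm_cutoff_le (R : ℕ) (x : EuclideanSpace ℝ (Fin n)) : ‖cutoff n R x‖ ≤ 1 := by
  rw [cutoff, Real.norm_of_nonneg (ContDiffBump.nonneg _)]
  exact ContDiffBump.le_one _

theorem tendsto_cutoff (x : EuclideanSpace ℝ (Fin n)) :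
    Tendsto (fun R => cutoff n R x) atTop (𝓝 1) := by
  have h1 : Tendsto (fun R : ℕ => (1 / ((R : ℝ) + 1)) • x) atTop (𝓝 0) := by
    simpa using (tendsto_one_div_add_atTop_nhds_zero_nat (𝕜 := ℝ)).smul_const x
  refine tendsto_const_nhds.congr' ?_
  filter_upwards [h1.eventually (Metric.closedBall_mem_nhds 0 one_pos)] with R hR
  exact (ContDiffBump.one_of_mem_closedBall _ hR).symm

/-- The cutoffs are dilates of one bump function, so the chain rule gives the factor 1/(R+1)
uniformly in x; this is what makes the cutoff errors disappear. -/
theorem exists_norm_pderiv_cutoff_le (n : ℕ) : ∃ C : ℝ, 0 ≤ C ∧ ∀ (j : Fin n) (R : ℕ)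
    (x : EuclideanSpace ℝ (Fin n)), ‖pderiv j (cutoff n R) x‖ ≤ C * (1 / ((R : ℝ) + 1)) := by
  let b : ContDiffBump (0 : EuclideanSpace ℝ (Fin n)) := ⟨1, 2, one_pos, one_lt_two⟩
  have hb : ContDiff ℝ 1 b := b.contDiff
  obtain ⟨C, hC⟩ := (b.hasCompactSupport.fderiv (𝕜 := ℝ)).exists_bound_of_continuous
    (hb.continuous_fderiv (by simp))
  refine ⟨C, (norm_nonneg _).trans (hC 0), fun j R x => ?_⟩
  have h1 := ((hb.differentiable (by simp) ((1 / ((R : ℝ) + 1)) • x)).hasFDerivAt).comp x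
    ((hasFDerivAt_id x).const_smul (1 / ((R : ℝ) + 1)))
  have h2 : pderiv j (cutoff n R) x = (1 / ((R : ℝ) + 1)) *
      fderiv ℝ b ((1 / ((R : ℝ) + 1)) • x) (EuclideanSpace.single j 1) := by
    unfold pderiv
    rw [show cutoff n R = b ∘ HSMul.hSMul (1 / ((R : ℝ) + 1)) from rfl, h1.fderiv]
    simp
  rw [h2, norm_mul, mul_comm, Real.norm_of_nonneg (by positivity : 0 ≤ 1 / ((R : ℝ) + 1))]
  gcongr
  refine (ContinuousLinearMap.le_opNorm _ _).trans ?_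
  simpa using hC _

/-- The a priori estimate for weak pairs. -/
theorem IsWeakPair.estimate (hφ : ContDiff ℝ ∞ φ) {c : ℝ}
    (hconv : ∀ x w : EuclideanSpace ℝ (Fin n),
      c * ‖w‖ ^ 2 ≤ ∑ j : Fin n, ∑ k : Fin n, pderiv j (pderiv k φ) x * w j * w k)
    (h : IsWeakPair φ g s)
    (hg : ∀ I, MemLp (fun x => Real.exp (-φ x / 2) * g.coeff I x) 2 volume)
    (hs : ∀ I, MemLp (fun x => Real.exp (-φ x / 2) * s.coeff I x) 2 volume) :
    c * ((r : ℝ) + 1) * ∫ x, (∑ M : Fin (r + 1) ↪o Fin n, g.coeff M x ^ 2) * Real.exp (-φ x) ≤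
      ∫ x, (∑ K : Fin r ↪o Fin n, s.coeff K x ^ 2) * Real.exp (-φ x) := by
  rw [integral_sum_sq_mul_exp hg, integral_sum_sq_mul_exp hs]
  have hc1 : ∀ {h : EuclideanSpace ℝ (Fin n) → ℝ}, MemLp h 2 volume →
      L2Tendsto (fun R x => cutoff n R x * h x) (fun x => 1 * h x) := fun hh =>
    L2Tendsto.of_bounded_mul (fun R => (contDiff_cutoff R).continuous) norm_cutoff_le
      tendsto_cutoff hh
  obtain ⟨C, hC0, hC⟩ := exists_norm_pderiv_cutoff_le n
  -- Error terms containing ∂χ_R tend to 0 in L². The scalar a stands for the sign (-1)^k from d, or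
  -- for 1 in the codifferential.
  have hc2 : ∀ (a : ℝ) (j : Fin n) {h : EuclideanSpace ℝ (Fin n) → ℝ}, ‖a‖ ≤ 1 →
      MemLp h 2 volume →
      L2Tendsto (fun R x => (a * pderiv j (cutoff n R) x) * h x) (fun x => 0 * h x) := by
    intro a j h ha hh
    have hb : ∀ R x, ‖a * pderiv j (cutoff n R) x‖ ≤ C * (1 / ((R : ℝ) + 1)) := by
      intro R x
      rw [norm_mul]
      calc ‖a‖ * ‖pderiv j (cutoff n R) x‖ ≤ 1 * (C * (1 / ((R : ℝ) + 1))) := by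
            gcongr
            exact hC j R x
        _ = _ := one_mul _
    refine L2Tendsto.of_bounded_mul (C := C)
      (fun R => continuous_const.mul ((contDiff_cutoff R).pderiv j).continuous)
      (fun R x => (hb R x).trans ?_) (fun x => ?_) hh
    · refine mul_le_of_le_one_right hC0 ?_
      rw [div_le_one (by positivity)]
      linarith [R.cast_nonneg (α := ℝ)]
    · have h0 : Tendsto (fun R : ℕ => C * (1 / ((R : ℝ) + 1))) atTop (𝓝 0) := by
        simpa using (tendsto_one_div_add_atTop_nhds_zero_nat (𝕜 := ℝ)).const_mul C
      exact squeeze_zero_norm (fun R => hb R x) h0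
  have hgt : ∀ v, MemLp (fun x => Real.exp (-φ x / 2) * g x v) 2 volume :=
    DForm.memLp_apply hg
  have t1 := fun M : Fin (r + 1) ↪o Fin n => (hc1 (hg M)).tendsto_integral_sq
  have t2 := fun K : Fin r ↪o Fin n => ((hc1 (hs K)).sub (L2Tendsto.sum Finset.univ
    fun (j : Fin n) _ => hc2 1 j (by simp)
      (hgt (basisTuple (Fin.cons j K : Fin (r + 1) → Fin n))))).tendsto_integral_sq
  have t3 := fun M : Fin (r + 2) ↪o Fin n => (L2Tendsto.sum Finset.univ
    fun (k : Fin (r + 2)) _ => hc2 ((-1) ^ (k : ℕ)) (M k) (by simp)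
      (hg (removeIndex M k))).tendsto_integral_sq
  simp only [one_mul, zero_mul, Finset.sum_const_zero, sub_zero] at t1 t2 t3
  have hlim := le_of_tendsto_of_tendsto'
    ((tendsto_finsetSum _ fun M _ => t1 M).const_mul (c * ((r : ℝ) + 1)))
    ((tendsto_finsetSum _ fun K _ => t2 K).add (tendsto_finsetSum _ fun M _ => t3 M))
    fun R => h.cutoff_estimate hφ hconv (contDiff_cutoff R) (hasCompactSupport_cutoff R)
  simpa using hlim

end WeakEstimate

/-! ### The weighted Hilbert space and its link with forms -/

section WeightedSpace

open Filter Topology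

variable {n q : ℕ} {φ : EuclideanSpace ℝ (Fin n) → ℝ}

/-- The Hilbert space of square integrable coefficient vectors of `q`-forms. -/
abbrev FormL2 (n q : ℕ) : Type :=
  Lp (EuclideanSpace ℝ (Fin q ↪o Fin n)) 2 (volume : Measure (EuclideanSpace ℝ (Fin n)))

/-- The coefficient vector of a form, multiplied by `e^{-φ/2}`. -/
def weightedVec (φ : EuclideanSpace ℝ (Fin n) → ℝ)
    (F : (Fin q ↪o Fin n) → EuclideanSpace ℝ (Fin n) → ℝ) (x : EuclideanSpace ℝ (Fin n)) :
    EuclideanSpace ℝ (Fin q ↪o Fin n) :=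
  WithLp.toLp 2 fun I => Real.exp (-φ x / 2) * F I x

theorem memLp_weightedVec {F : (Fin q ↪o Fin n) → EuclideanSpace ℝ (Fin n) → ℝ}
    (hF : ∀ I, MemLp (fun x => Real.exp (-φ x / 2) * F I x) 2 volume) :
    MemLp (weightedVec φ F) 2 volume :=
  MemLp.of_eval_piLp hF

theorem inner_toLp_weightedVec {F G : (Fin q ↪o Fin n) → EuclideanSpace ℝ (Fin n) → ℝ}
    (hF : MemLp (weightedVec φ F) 2 volume) (hG : MemLp (weightedVec φ G) 2 volume) :
    inner ℝ (hF.toLp _) (hG.toLp _) = ∫ x, (∑ I, F I x * G I x) * Real.exp (-φ x) := by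
  rw [L2.inner_def]
  refine integral_congr_ae ?_
  filter_upwards [hF.coeFn_toLp, hG.coeFn_toLp] with x h1 h2
  rw [h1, h2, PiLp.inner_apply, Finset.sum_mul]
  refine Finset.sum_congr rfl fun I _ => ?_
  simp only [weightedVec, RCLike.inner_apply, conj_trivial]
  rw [← exp_neg_half_sq]
  ring

theorem norm_sq_toLp_weightedVec {F : (Fin q ↪o Fin n) → EuclideanSpace ℝ (Fin n) → ℝ}
    (hF : MemLp (weightedVec φ F) 2 volume) :
    ‖hF.toLp _‖ ^ 2 = ∫ x, (∑ I, F I x ^ 2) * Real.exp (-φ x) := by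
  rw [← real_inner_self_eq_norm_sq, inner_toLp_weightedVec]
  simp_rw [pow_two]

/-- The form represented by an element of the Hilbert space. -/
def unweightedForm (φ : EuclideanSpace ℝ (Fin n) → ℝ) (u : FormL2 n q) : DForm n q := fun x =>
  ∑ I : Fin q ↪o Fin n, (Real.exp (φ x / 2) * u x I) • elemForm I

theorem coeff_unweightedForm (u : FormL2 n q) (I : Fin q ↪o Fin n)
    (x : EuclideanSpace ℝ (Fin n)) :
    (unweightedForm φ u).coeff I x = Real.exp (φ x / 2) * u x I := by
  rw [DForm.coeff_eq, unweightedForm, ContinuousAlternatingMap.sum_apply]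
  simp [elemForm_basisTuple]

theorem exp_neg_half_mul_coeff_unweightedForm (u : FormL2 n q) (I : Fin q ↪o Fin n)
    (x : EuclideanSpace ℝ (Fin n)) :
    Real.exp (-φ x / 2) * (unweightedForm φ u).coeff I x = u x I := by
  rw [coeff_unweightedForm, ← mul_assoc, ← Real.exp_add]
  ring_nf
  simp

theorem weightedVec_unweightedForm (u : FormL2 n q) :
    weightedVec φ (unweightedForm φ u).coeff = u := by
  funext x
  ext I
  exact exp_neg_half_mul_coeff_unweightedForm u I x

theorem memLp_coeff_unweightedForm (u : FormL2 n q) (I : Fin q ↪o Fin n) :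
    MemLp (fun x => Real.exp (-φ x / 2) * (unweightedForm φ u).coeff I x) 2 volume := by
  simp_rw [exp_neg_half_mul_coeff_unweightedForm]
  exact (Lp.memLp u).eval_piLp I

theorem toLp_unweightedForm (u : FormL2 n q) :
    (memLp_weightedVec (memLp_coeff_unweightedForm (φ := φ) u)).toLp _ = u := by
  have h : ∀ (v : EuclideanSpace ℝ (Fin n) → EuclideanSpace ℝ (Fin q ↪o Fin n))
      (hv : MemLp v 2 volume), v = u → hv.toLp v = u := by
    rintro _ hv rfl
    exact Lp.toLp_coeFn u hv
  exact h _ _ (weightedVec_unweightedForm u)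

theorem locL2_of_memLp_weighted (hφ : Continuous φ) {h : EuclideanSpace ℝ (Fin n) → ℝ}
    (hh : MemLp (fun x => Real.exp (-φ x / 2) * h x) 2 volume) : LocL2 h := by
  have h1 := (MemLp.locL2 hh).continuous_mul (b := fun x => Real.exp (φ x / 2)) (by fun_prop)
  convert h1 using 2 with x
  rw [← mul_assoc, ← Real.exp_add]
  ring_nf
  simp

theorem DForm.dot_self_mul_exp (f : DForm n q) (x : EuclideanSpace ℝ (Fin n)) :
    f.dot f x * Real.exp (-φ x) = ∑ I, (Real.exp (-φ x / 2) * f.coeff I x) ^ 2 := by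
  rw [DForm.dot, Finset.sum_mul]
  refine Finset.sum_congr rfl fun I _ => ?_
  rw [mul_pow, exp_neg_half_sq]
  ring

theorem DForm.MemL2.memLp_weighted (hφ : Continuous φ) {f : DForm n q} (hf : f.MemL2 φ)
    (I : Fin q ↪o Fin n) : MemLp (fun x => Real.exp (-φ x / 2) * f.coeff I x) 2 volume := by
  have hE : Continuous fun x => Real.exp (-φ x / 2) := by fun_prop
  have hm : AEStronglyMeasurable (fun x => Real.exp (-φ x / 2) * f.coeff I x) volume := by
    have h1 : LocL2 (f.coeff I) := hf.memLp_loc I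
    exact hE.aestronglyMeasurable.mul h1.locallyIntegrable.aestronglyMeasurable
  rw [memLp_two_iff_integrable_sq hm]
  refine hf.integrable.mono' (hm.pow 2) (Eventually.of_forall fun x => ?_)
  rw [DForm.dot_self_mul_exp, Real.norm_of_nonneg (sq_nonneg _)]
  exact Finset.single_le_sum (f := fun I => (Real.exp (-φ x / 2) * f.coeff I x) ^ 2)
    (fun _ _ => sq_nonneg _) (Finset.mem_univ I)

theorem DForm.memL2_of_memLp_weighted (hφ : Continuous φ) {f : DForm n q}
    (hf : ∀ I, MemLp (fun x => Real.exp (-φ x / 2) * f.coeff I x) 2 volume) : f.MemL2 φ where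
  memLp_loc I := locL2_of_memLp_weighted hφ (hf I)
  integrable := by
    simp_rw [DForm.dot_self_mul_exp]
    exact integrable_finsetSum _ fun I _ => (hf I).integrable_sq

theorem DForm.weightedNormSq_eq (f : DForm n q) :
    f.weightedNormSq φ = ∫ x, (∑ I, f.coeff I x ^ 2) * Real.exp (-φ x) := by
  simp_rw [DForm.weightedNormSq, DForm.dot, pow_two]

/-- The space of test forms. -/
def testForms (n q : ℕ) : Submodule ℝ (DForm n q) where
  carrier := {α | α.IsTest}
  add_mem' ha hb := ⟨ha.smooth.add hb.smooth, ha.compact.add hb.compact⟩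
  zero_mem' := ⟨contDiff_const, HasCompactSupport.zero⟩
  smul_mem' c _ ha := ⟨contDiff_const.smul ha.smooth,
    ha.compact.comp_left (g := fun A => c • A) (smul_zero c)⟩

theorem memLp_weighted_of_hasCompactSupport (hφ : Continuous φ)
    {F : EuclideanSpace ℝ (Fin n) → ℝ} (hF : Continuous F) (hc : HasCompactSupport F) :
    MemLp (fun x => Real.exp (-φ x / 2) * F x) 2 volume :=
  Continuous.memLp_of_hasCompactSupport (by fun_prop) hc.mul_left

theorem DForm.IsTest.memLp_weightedVec (hφ : Continuous φ) {α : DForm n q} (hα : α.IsTest) :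
    MemLp (weightedVec φ α.coeff) 2 volume :=
  _root_.memLp_weightedVec fun _ => memLp_weighted_of_hasCompactSupport hφ
    (hα.smooth.alternating_apply _).continuous (hα.compact.alternating_apply _)

theorem DForm.IsTest.memLp_codiff (hφ : ContDiff ℝ ∞ φ) {α : DForm n (q + 1)} (hα : α.IsTest) :
    MemLp (weightedVec φ (codiff φ α)) 2 volume :=
  _root_.memLp_weightedVec fun K => memLp_weighted_of_hasCompactSupport hφ.continuous
    (contDiff_codiff hφ hα.smooth K).continuous (hasCompactSupport_codiff hα.compact K)

/-- Test forms as elements of the Hilbert space. -/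
def testToL2 (hφ : Continuous φ) : testForms n q →ₗ[ℝ] FormL2 n q where
  toFun α := (DForm.IsTest.memLp_weightedVec hφ α.2).toLp _
  map_add' α β := by
    rw [← MemLp.toLp_add]
    congr 1
    funext x
    ext I
    simp only [weightedVec, DForm.coeff_eq, Pi.add_apply, PiLp.add_apply, Submodule.coe_add,
      ContinuousAlternatingMap.add_apply]
    ring
  map_smul' c α := by
    rw [RingHom.id_apply, ← MemLp.toLp_const_smul]
    congr 1
    funext x
    ext I
    simp only [weightedVec, DForm.coeff_eq, Pi.smul_apply, PiLp.smul_apply, Submodule.coe_smul,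
      ContinuousAlternatingMap.smul_apply, smul_eq_mul]
    ring

/-- The weighted codifferential of test forms as elements of the Hilbert space. -/
def codiffToL2 (hφ : ContDiff ℝ ∞ φ) : testForms n (q + 1) →ₗ[ℝ] FormL2 n q where
  toFun α := (DForm.IsTest.memLp_codiff hφ α.2).toLp _
  map_add' α β := by
    rw [← MemLp.toLp_add]
    congr 1
    funext x
    ext I
    have ha := α.2.smooth
    have hb := β.2.smooth
    simp only [weightedVec, Pi.add_apply, PiLp.add_apply]
    rw [codiff_eq hφ ha, codiff_eq hφ hb, codiff_eq hφ (α + β).2.smooth, ← mul_add, ← neg_add,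
      ← Finset.sum_add_distrib]
    congr 2
    refine Finset.sum_congr rfl fun j _ => ?_
    have := pderiv_add (ha.alternating_apply (basisTuple (Fin.cons j I : Fin (q + 1) → Fin n)))
      (hb.alternating_apply (basisTuple (Fin.cons j I : Fin (q + 1) → Fin n))) j x
    simp only [Submodule.coe_add, Pi.add_apply, ContinuousAlternatingMap.add_apply]
    rw [this]
    ring
  map_smul' c α := by
    rw [RingHom.id_apply, ← MemLp.toLp_const_smul]
    congr 1
    funext x
    ext I
    have ha := α.2.smooth
    simp only [weightedVec, Pi.smul_apply, PiLp.smul_apply, smul_eq_mul]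
    rw [codiff_eq hφ ha, codiff_eq hφ (c • α).2.smooth, mul_left_comm, mul_neg c, Finset.mul_sum]
    congr 2
    refine Finset.sum_congr rfl fun j _ => ?_
    have := pderiv_const_mul
      (ha.alternating_apply (basisTuple (Fin.cons j I : Fin (q + 1) → Fin n))) c j x
    simp only [Submodule.coe_smul, Pi.smul_apply, ContinuousAlternatingMap.smul_apply, smul_eq_mul]
    rw [this]
    ring

/-- The pairing of a form with the codifferential of a test form is the distributional
exterior derivative. -/
theorem sum_weakDCoeff_exp_smul (hφ : ContDiff ℝ ∞ φ) {u : DForm n q}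
    (hu : ∀ I, LocL2 (u.coeff I)) {β : DForm n (q + 1)} (hβ : β.IsTest) :
    ∑ M : Fin (q + 1) ↪o Fin n,
        u.weakDCoeff M (DForm.coeff (fun x => Real.exp (-φ x) • β x) M) =
      ∫ x, (∑ K, u.coeff K x * codiff φ β K x) * Real.exp (-φ x) := by
  rw [sum_weakDCoeff (α := fun x => Real.exp (-φ x) • β x)
    (fun I => (hu I).locallyIntegrable) (hβ.smul hφ.neg.exp), ← integral_neg]
  congr 1
  funext x
  rw [Finset.sum_mul, ← Finset.sum_neg_distrib]
  refine Finset.sum_congr rfl fun K _ => ?_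
  simp only [ContinuousAlternatingMap.smul_apply, smul_eq_mul, codiff]
  have : Real.exp (φ x) * Real.exp (-φ x) = 1 := by rw [← Real.exp_add]; simp
  linear_combination (u.coeff K x * ∑ j : Fin n, pderiv j (fun y => Real.exp (-φ y) *
    β y (basisTuple (Fin.cons j K : Fin (q + 1) → Fin n))) x) * this

/-- Every test form is e^{-φ} times a test form, so pairing with `codiff` on all test forms is
equivalent to the unweighted distributional equation. -/
theorem exp_neg_smul_exp_smul (α : DForm n q) :
    (fun x => Real.exp (-φ x) • Real.exp (φ x) • α x) = α := by
  funext x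
  rw [smul_smul, ← Real.exp_add]
  simp

/-- Orthogonality relations against test forms give a weak pair. -/
theorem isWeakPair_of_forall_test (hφ : ContDiff ℝ ∞ φ) {g : DForm n (q + 1)} {s : DForm n q}
    (hg : ∀ I, LocL2 (g.coeff I)) (hs : ∀ I, LocL2 (s.coeff I))
    (hclosed : ∀ β : DForm n (q + 2), β.IsTest →
      ∫ x, (∑ K, g.coeff K x * codiff φ β K x) * Real.exp (-φ x) = 0)
    (hcoclosed : ∀ γ : DForm n q, γ.IsTest →
      ∫ x, (∑ M : Fin (q + 1) ↪o Fin n, g.coeff M x * extDeriv γ x (basisTuple M)) *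
        Real.exp (-φ x) = ∫ x, (∑ K, s.coeff K x * γ.coeff K x) * Real.exp (-φ x)) :
    IsWeakPair φ g s where
  locL2_left := hg
  locL2_right := hs
  closed M η hη hc := by
    have htest : DForm.IsTest (n := n) (p := q + 2) fun x => η x • elemForm M :=
      DForm.isTest_smul_const hη hc _
    -- Testing on e^{φ} η dx^M isolates the single coefficient M of dg, and e^{φ} compensates the
    -- weight.
    have h1 := hclosed _ (htest.smul hφ.exp)
    rw [← sum_weakDCoeff_exp_smul hφ hg (htest.smul hφ.exp), exp_neg_smul_exp_smul,
      sum_weakDCoeff (fun I => (hg I).locallyIntegrable) htest, neg_eq_zero] at h1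
    rw [← h1]
    congr 1
    funext x
    have h2 := sum_neg_one_pow_removeIndex (fun j K => pderiv j η x * g.coeff K x)
      (fun _ => elemForm M)
    have h3 : ∀ v, ∀ j : Fin n, pderiv j (fun y => (η y • elemForm M) v) x =
        pderiv j η x * elemForm M v := by
      intro v j
      simp only [ContinuousAlternatingMap.smul_apply, smul_eq_mul]
      simp_rw [mul_comm _ (elemForm M v)]
      exact pderiv_const_mul hη _ j x
    simp_rw [h3, Finset.mul_sum]
    rw [Finset.sum_congr rfl fun K _ => Finset.sum_congr rfl fun j _ =>
      (show _ = pderiv j η x * g.coeff K x * elemForm M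
        (basisTuple (Fin.cons j K : Fin (q + 2) → Fin n)) by ring), ← h2,
      Finset.sum_eq_single M]
    · refine Finset.sum_congr rfl fun k _ => ?_
      rw [elemForm_basisTuple, if_pos rfl]
      ring
    · intro M' _ hM'
      refine Finset.sum_eq_zero fun k _ => ?_
      rw [elemForm_basisTuple, if_neg hM']
      ring
    · simp
  coclosed K η hη hc := by
    have hζ : ContDiff ℝ ∞ fun x => Real.exp (φ x) * η x := hφ.exp.mul hη
    -- Here too e^{φ} cancels the weight, but d now differentiates it as well: this is the origin of
    -- the ∂_jφ terms in the coclosed equation.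
    have htest : DForm.IsTest (n := n) (p := q)
        fun x => (Real.exp (φ x) * η x) • elemForm K :=
      DForm.isTest_smul_const hζ hc.mul_left _
    have h1 := hcoclosed _ htest
    have hexp : ∀ x, Real.exp (φ x) * Real.exp (-φ x) = 1 := fun x => by
      rw [← Real.exp_add]; simp
    have hl : ∀ v, LocL2 fun x => g x v := DForm.locL2_apply hg
    have hcoeff : ∀ (L : Fin q ↪o Fin n) y,
        ((Real.exp (φ y) * η y) • elemForm K) (basisTuple L) =
          (if L = K then 1 else 0) * (Real.exp (φ y) * η y) := by
      intro L y
      rw [ContinuousAlternatingMap.smul_apply, smul_eq_mul, elemForm_basisTuple, mul_comm]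
    have e1 : ∀ x, (∑ M : Fin (q + 1) ↪o Fin n, g.coeff M x *
        extDeriv (fun x => (Real.exp (φ x) * η x) • elemForm K) x (basisTuple M)) *
          Real.exp (-φ x) =
        (∑ j : Fin n, pderiv j η x * g x (basisTuple (Fin.cons j K : Fin (q + 1) → Fin n))) +
        η x * ∑ j : Fin n,
          pderiv j φ x * g x (basisTuple (Fin.cons j K : Fin (q + 1) → Fin n)) := by
      intro x
      have h2 := sum_mul_extDeriv (g x) htest.smooth x
      simp_rw [DForm.coeff_eq]
      rw [h2, Finset.sum_eq_single K, Finset.mul_sum, ← Finset.sum_add_distrib, Finset.sum_mul]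
      · refine Finset.sum_congr rfl fun j _ => ?_
        simp_rw [hcoeff, if_pos, one_mul]
        rw [pderiv_mul hφ.exp hη, pderiv_exp hφ]
        linear_combination ((pderiv j φ x * η x + pderiv j η x) *
          g x (basisTuple (Fin.cons j K : Fin (q + 1) → Fin n))) * hexp x
      · intro L _ hL
        refine Finset.sum_eq_zero fun j _ => ?_
        simp_rw [hcoeff, if_neg hL, zero_mul]
        simp [pderiv]
      · simp
    have e2 : ∀ x, (∑ L, s.coeff L x *
        DForm.coeff (fun x => (Real.exp (φ x) * η x) • elemForm K) L x) * Real.exp (-φ x) =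
        η x * s.coeff K x := by
      intro x
      have hcoeff' : ∀ L, DForm.coeff (fun x => (Real.exp (φ x) * η x) • elemForm K) L x =
          (if L = K then 1 else 0) * (Real.exp (φ x) * η x) := fun L => hcoeff L x
      rw [Finset.sum_eq_single K]
      · rw [hcoeff', if_pos rfl]
        linear_combination (s.coeff K x * η x) * hexp x
      · intro L _ hL
        rw [hcoeff', if_neg hL]
        ring
      · simp
    simp_rw [e1, e2] at h1
    have i1 : Integrable fun x => ∑ j : Fin n,
        pderiv j η x * g x (basisTuple (Fin.cons j K : Fin (q + 1) → Fin n)) :=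
      integrable_finsetSum _ fun j _ =>
        (hl _).locallyIntegrable.integrable_smul_left_of_hasCompactSupport
          (hη.pderiv j).continuous (hc.pderiv j)
    have i2 : Integrable fun x => η x * ∑ j : Fin n,
        pderiv j φ x * g x (basisTuple (Fin.cons j K : Fin (q + 1) → Fin n)) :=
      (LocL2.sum Finset.univ fun j _ => (hl (basisTuple (Fin.cons j K : Fin (q + 1) →
        Fin n))).continuous_mul (hφ.pderiv j).continuous).locallyIntegrable
          |>.integrable_smul_left_of_hasCompactSupport hη.continuous hc
    have i3 : Integrable fun x => η x * s.coeff K x :=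
      (hs K).locallyIntegrable.integrable_smul_left_of_hasCompactSupport hη.continuous hc
    rw [integral_add i1 i2] at h1
    simp_rw [mul_sub]
    rw [integral_sub i3 i2, ← h1]
    ring

end WeightedSpace

/-! ### Pairings of test forms and solvability in the Hilbert space -/

section DualityPairings

variable {n q : ℕ} {φ : EuclideanSpace ℝ (Fin n) → ℝ}

theorem inner_toLp_testToL2 (hφ : Continuous φ)
    {F : (Fin q ↪o Fin n) → EuclideanSpace ℝ (Fin n) → ℝ}
    (hF : MemLp (weightedVec φ F) 2 volume) (β : testForms n q) :
    inner ℝ (hF.toLp _) (testToL2 hφ β) =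
      ∫ x, (∑ I, F I x * DForm.coeff β.1 I x) * Real.exp (-φ x) :=
  inner_toLp_weightedVec hF (DForm.IsTest.memLp_weightedVec hφ β.2)

theorem inner_toLp_codiffToL2 (hφ : ContDiff ℝ ∞ φ)
    {F : (Fin q ↪o Fin n) → EuclideanSpace ℝ (Fin n) → ℝ}
    (hF : MemLp (weightedVec φ F) 2 volume) (β : testForms n (q + 1)) :
    inner ℝ (hF.toLp _) (codiffToL2 hφ β) =
      ∫ x, (∑ I, F I x * codiff φ β.1 I x) * Real.exp (-φ x) :=
  inner_toLp_weightedVec hF (DForm.IsTest.memLp_codiff hφ β.2)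

/-- The exterior derivative on test forms. -/
def testExtDeriv (γ : testForms n q) : testForms n (q + 1) :=
  ⟨extDeriv γ.1, DForm.isTest_extDeriv γ.2⟩

theorem inner_testToL2_testExtDeriv (hφ : ContDiff ℝ ∞ φ) (β : testForms n (q + 1))
    (γ : testForms n q) :
    inner ℝ (testToL2 hφ.continuous β) (testToL2 hφ.continuous (testExtDeriv γ)) =
      inner ℝ (codiffToL2 hφ β) (testToL2 hφ.continuous γ) := by
  have h1 := inner_toLp_testToL2 hφ.continuous
    (DForm.IsTest.memLp_weightedVec hφ.continuous β.2) (testExtDeriv γ)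
  have h2 := inner_toLp_testToL2 hφ.continuous (DForm.IsTest.memLp_codiff hφ β.2) γ
  exact h1.trans ((integral_codiff_mul hφ β.2 γ.2.smooth).trans h2.symm)

theorem testExtDeriv_testExtDeriv (γ : testForms n q) : testExtDeriv (testExtDeriv γ) = 0 := by
  apply Subtype.ext
  exact extDeriv_extDeriv γ.2.smooth (by
    rw [minSmoothness_of_isRCLikeNormedField]; exact WithTop.coe_le_coe.2 le_top)

/-- The dual form of d² = 0: exact test forms are orthogonal to the range of the codifferential,
hence weakly closed. -/
theorem inner_codiffToL2_testExtDeriv (hφ : ContDiff ℝ ∞ φ) (β : testForms n (q + 2))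
    (γ : testForms n q) :
    inner ℝ (codiffToL2 hφ β) (testToL2 hφ.continuous (testExtDeriv γ)) = 0 := by
  rw [← inner_testToL2_testExtDeriv, testExtDeriv_testExtDeriv, map_zero, inner_zero_right]

/-- The a priori estimate in the Hilbert space. -/
theorem mul_norm_sq_le_of_weakly_closed (hφ : ContDiff ℝ ∞ φ) {c : ℝ}
    (hconv : ∀ x w : EuclideanSpace ℝ (Fin n),
      c * ‖w‖ ^ 2 ≤ ∑ j : Fin n, ∑ k : Fin n, pderiv j (pderiv k φ) x * w j * w k)
    (g : FormL2 n (q + 1)) (s : FormL2 n q)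
    (hg : ∀ w ∈ Set.range (codiffToL2 (n := n) (q := q + 1) hφ), inner ℝ w g = 0)
    (hs : ∀ γ : testForms n q, inner ℝ g (testToL2 hφ.continuous (testExtDeriv γ)) =
      inner ℝ s (testToL2 hφ.continuous γ)) :
    c * ((q : ℝ) + 1) * ‖g‖ ^ 2 ≤ ‖s‖ ^ 2 := by
  have hgw := memLp_coeff_unweightedForm (φ := φ) g
  have hsw := memLp_coeff_unweightedForm (φ := φ) s
  have hgL := memLp_weightedVec hgw
  have hsL := memLp_weightedVec hsw
  have eg : hgL.toLp _ = g := toLp_unweightedForm g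
  have es : hsL.toLp _ = s := toLp_unweightedForm s
  have hpair : IsWeakPair φ (unweightedForm φ g) (unweightedForm φ s) := by
    refine isWeakPair_of_forall_test hφ (fun I => locL2_of_memLp_weighted hφ.continuous (hgw I))
      (fun I => locL2_of_memLp_weighted hφ.continuous (hsw I)) (fun β hβ => ?_) (fun γ hγ => ?_)
    · have h1 := hg _ ⟨⟨β, hβ⟩, rfl⟩
      rw [real_inner_comm, ← eg, inner_toLp_codiffToL2] at h1
      exact h1
    · have h1 := hs ⟨γ, hγ⟩
      rw [← eg, ← es, inner_toLp_testToL2, inner_toLp_testToL2] at h1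
      exact h1
  have hest := hpair.estimate hφ hconv hgw hsw
  rwa [← norm_sq_toLp_weightedVec hgL, ← norm_sq_toLp_weightedVec hsL, eg, es] at hest

/-- Solvability of the weak equation in the Hilbert space. -/
theorem exists_formL2_solution (hφ : ContDiff ℝ ∞ φ) {c : ℝ} (hc : 0 < c)
    (hconv : ∀ x w : EuclideanSpace ℝ (Fin n),
      c * ‖w‖ ^ 2 ≤ ∑ j : Fin n, ∑ k : Fin n, pderiv j (pderiv k φ) x * w j * w k)
    (f : FormL2 n (q + 1))
    (hf : ∀ w ∈ Set.range (codiffToL2 (n := n) (q := q + 1) hφ), inner ℝ w f = 0) :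
    ∃ u : FormL2 n q, (∀ α : testForms n (q + 1),
      inner ℝ u (codiffToL2 hφ α) = inner ℝ f (testToL2 hφ.continuous α)) ∧
      ‖u‖ ^ 2 ≤ 1 / (c * ((q : ℝ) + 1)) * ‖f‖ ^ 2 := by
  have hκ : 0 < c * ((q : ℝ) + 1) := by positivity
  have hadj := inner_testToL2_testExtDeriv (n := n) (q := q) hφ
  -- The set W is the range of the codifferential on test (q+2)-forms; being orthogonal to it is
  -- weak closedness.
  have hW : ∀ w ∈ Set.range (codiffToL2 (n := n) (q := q + 1) hφ), ∀ γ : testForms n q,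
      inner ℝ w (testToL2 hφ.continuous (testExtDeriv γ)) = 0 := by
    rintro _ ⟨β, rfl⟩ γ
    exact inner_codiffToL2_testExtDeriv hφ β γ
  have h := @exists_solution_of_estimate (testForms n q) (testForms n (q + 1)) (FormL2 n q)
    (FormL2 n (q + 1)) _ _ _ _ _ _ _ _ (testToL2 hφ.continuous)
    (fun γ => testToL2 hφ.continuous (testExtDeriv γ)) (testToL2 hφ.continuous) (codiffToL2 hφ)
    (Set.range (codiffToL2 (n := n) (q := q + 1) hφ)) _ hκ
  exact h hadj hW (mul_norm_sq_le_of_weakly_closed hφ hconv) f hf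

end DualityPairings

end

/-! ### The theorem for forms -/

theorem mainTheorem2 (n p : ℕ) (hp : p + 1 ≤ n)
    (φ : EuclideanSpace ℝ (Fin n) → ℝ) (hφ : ContDiff ℝ ∞ φ)
    (c : ℝ) (hc : 0 < c)
    (hconv : ∀ x w : EuclideanSpace ℝ (Fin n),
      c * ‖w‖ ^ 2 ≤ ∑ j : Fin n, ∑ k : Fin n, pderiv j (pderiv k φ) x * w j * w k)
    (f : DForm n (p + 1)) (hf : f.MemL2 φ) (hclosed : f.WeakD (0 : DForm n (p + 2))) :
    ∃ u : DForm n p, u.MemL2 φ ∧ u.WeakD f ∧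
      u.weightedNormSq φ ≤ 1 / (c * ((p : ℝ) + 1)) * f.weightedNormSq φ := by
  have hφc := hφ.continuous
  have hfw := hf.memLp_weighted hφc
  have hfL := memLp_weightedVec hfw
  -- The distributional equation df = 0 is tested on e^{-φ}β, which makes f orthogonal to every δβ.
  have hforth : ∀ w ∈ Set.range (codiffToL2 (n := n) (q := p + 1) hφ),
      inner ℝ w (hfL.toLp _) = 0 := by
    rintro _ ⟨β, rfl⟩
    rw [real_inner_comm, inner_toLp_codiffToL2, ← sum_weakDCoeff_exp_smul hφ hf.memLp_loc β.2]
    refine (hclosed _ (DForm.IsTest.smul β.2 hφ.neg.exp)).trans ?_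
    simp [DForm.dot, DForm.coeff]
  obtain ⟨u, hu, hun⟩ := exists_formL2_solution hφ hc hconv (hfL.toLp _) hforth
  have huw := memLp_coeff_unweightedForm (φ := φ) u
  have huL := memLp_weightedVec huw
  have eu : huL.toLp _ = u := toLp_unweightedForm u
  refine ⟨unweightedForm φ u, DForm.memL2_of_memLp_weighted hφc huw, fun α hα => ?_, ?_⟩
  -- The Hilbert space equation is used at e^{φ}α, so that the weight disappears and du = f is
  -- tested on α itself.
  · have hβ := hα.smul hφ.exp
    have h2 := hu ⟨_, hβ⟩
    rw [← eu, inner_toLp_codiffToL2, inner_toLp_testToL2] at h2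
    rw [← sum_weakDCoeff_exp_smul hφ (fun I => locL2_of_memLp_weighted hφc (huw I)) hβ,
      exp_neg_smul_exp_smul] at h2
    rw [h2]
    congr 1
    funext x
    rw [DForm.dot, Finset.sum_mul]
    refine Finset.sum_congr rfl fun M _ => ?_
    have : Real.exp (φ x) * Real.exp (-φ x) = 1 := by rw [← Real.exp_add]; simp
    simp only [DForm.coeff_eq, ContinuousAlternatingMap.smul_apply, smul_eq_mul]
    linear_combination (f x (basisTuple M) * α x (basisTuple M)) * this
  · rw [DForm.weightedNormSq_eq, DForm.weightedNormSq_eq,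
      ← norm_sq_toLp_weightedVec huL, ← norm_sq_toLp_weightedVec hfL, eu]
    exact hun
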